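/- An analytic field is a field complete with respect to a non-trivial non-archimedean real-valued absolute value $|\ |$. For a valued field $K$ write $K^\circ=\{|x|\le 1\}$ for its ring of integers, $\widetilde K$ for its residue field, $|K^\times|$ for its value group, and $\widetilde z$ for the image in $\widetilde K$ of $z\in K^\circ$. For a finite extension $L/K$ of analytic fields put $e_{L/K}=\#(|L^\times|/|K^\times|)$, $f_{L/K}=[\widetilde L:\widetilde K]$ and $d_{L/K}=[L:K]/(e_{L/K}f_{L/K})$; $L/K$ is immediate if $e_{L/K}=f_{L/K}=1$. It is unramified if $K^\circ\to L^\circ$ is étale; when $\widetilde K$ has characteristic $p>0$, it is moderately ramified if there is an intermediate field $F$ with $F/K$ unramified and $[L:F]$ prime to $p$, and wildly ramified otherwise (in particular when it is inseparable). Let $K$ be an analytic field whose residue field has prime characteristic $p$. For $a\in K$ and $s>0$ put $$S_{a,s}(K)=\{c^p-ac+d \mid c,d\in K,\ |pc^p|<s,\ |d|<s\},$$ an additive subgroup of $K$. A coset $b+S_{a,s}(K)$ is split if it contains $0$; it is critical if it is not split and $\inf|b+S_{a,s}(K)|=s>0$; a critical coset is special if $a=0$, or $a=1$ and $s=1$.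 A coset $b+S_{a,s}(K)$ splits over an extension $L$ of $K$ if $b+S_{a,s}(L)$ is split. **Proposition.** Let $L/K$ be a wildly ramified extension of degree $p$ of analytic fields, where $p>0$ is the residue characteristic. (i) There exists a critical coset $b+S_{a,s}(K)$ which splits over $L$ and such that one of the following holds: (a) $a=0$; (b) $|a|=s^{(p-1)/p}$ and $s\notin|b+S_{a,s}(K)|$. Moreover, for every critical coset $b+S_{a,s}(K)$ as in (i): (ii) In case (a) the coset is special. In case (b), put $K'=K(a^{1/(p-1)})$ and $L'=L(a^{1/(p-1)})$, for any choice of the root; then $K'/K$ is moderately ramified, $L'/K'$ is wildly ramified of degree $p$, and there is a special coset over $K'$ which splits over $L'$ and satisfies the conditions of (b) over $K'$. (iii) In case (b), $L\cong K[T]/(T^p-aT+b)$ over $K$. (iv) The invariants $d=d_{L/K}$, $e=e_{L/K}$, $f=f_{L/K}$ are positive integers with $def=p$, and: - $L/K$ is immediate (equivalently, $d=p$) if and only if $s\notin|b+S_{a,s}(K)|$; in particular this is so in case (b). - $e=p$ if and only if $s\in|b+S_{a,s}(K)|$ and $s\notin|K^\times|^p$; in this case $s^{1/p}$ generates $|L^\times|$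 over $|K^\times|$. - $f=p$ if and only if $s\in|b+S_{a,s}(K)|$ and $s\in|K^\times|^p$; in this case $\widetilde L/\widetilde K$ is purely inseparable, and for all $y\in b+S_{a,s}(K)$ and $c\in K$ with $|y|=s$ and $|c|=s^{1/p}$ the element $(\widetilde{y/c^p})^{1/p}$ lies in $\widetilde L$ and generates $\widetilde L$ over $\widetilde K$. -/

import Mathlib

open scoped NNReal

namespace AnalyticField

noncomputable section

/-- The ring of integers `K° = {x : ‖x‖ ≤ 1}` of a non-archimedean normed field. -/
abbrev Integers (K : Type*) [NormedField K] [IsUltrametricDist K] : ValuationSubring K :=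
  (NormedField.valuation (K := K)).valuationSubring

/-- The residue field `K° / K°°`. -/
abbrev Residue (K : Type*) [NormedField K] [IsUltrametricDist K] : Type _ :=
  IsLocalRing.ResidueField (Integers K)

/-- If `L` is a normed algebra over `K`, its absolute value extends that of `K`. Through this
instance Mathlib provides the maps `K° → L°` and `K°/K°° → L°/L°°`. -/
instance hasExtension (K L : Type*) [NormedField K] [IsUltrametricDist K] [NormedField L]
    [IsUltrametricDist L] [NormedAlgebra K L] :
    (NormedField.valuation (K := K)).HasExtension (NormedField.valuation (K := L)) where
  val_isEquiv_comap x y := by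
    simp only [Valuation.comap_apply, NormedField.valuation_apply, ← NNReal.coe_le_coe, coe_nnnorm,
      norm_algebraMap']

/-- The group of absolute values `|K^×|`, inside `ℝ^×`. -/
def valueGroup (K : Type*) [NormedField K] : Subgroup ℝˣ :=
  (Units.map (normHom (α := K) : K →* ℝ)).range

section Invariants

variable (K L : Type*) [NormedField K] [IsUltrametricDist K] [NormedField L] [IsUltrametricDist L]
  [NormedAlgebra K L]

/-- The ramification index `e = #(|L^×| / |K^×|)`. -/
def ramificationIndex : ℕ :=
  (valueGroup K).relIndex (valueGroup L)

/-- The residue degree `f`, the degree of the residue field of `L` over that of `K`. -/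
def residueDegree : ℕ :=
  Module.finrank (Residue K) (Residue L)

/-- The defect `d = [L : K] / (e f)`. -/
def defect : ℚ :=
  (Module.finrank K L : ℚ) / ((ramificationIndex K L : ℚ) * (residueDegree K L : ℚ))

/-- `L / K` is immediate if `e = f = 1`. -/
def IsImmediate : Prop :=
  ramificationIndex K L = 1 ∧ residueDegree K L = 1

/-- A finite extension of valued fields of height one is unramified if `K° → L°` is étale. -/
def IsUnramified : Prop :=
  FiniteDimensional K L ∧ Algebra.Etale (Integers K) (Integers L)

/-- A finite extension `L / K` is moderately (tamely) ramified, with respect to the residue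
characteristic `p`, if it is an unramified extension `F / K` followed by an extension `L / F` of
degree prime to `p`. (For finite `L / F`, the degrees of all subextensions divide `[L : F]`.) -/
def IsModeratelyRamified (p : ℕ) : Prop :=
  FiniteDimensional K L ∧
    ∃ F : IntermediateField K L, IsUnramified K F ∧ (Module.finrank F L).Coprime p

/-- A finite extension is wildly ramified if it is not moderately ramified. In particular every
inseparable finite extension is wildly ramified. -/
def IsWildlyRamified (p : ℕ) : Prop :=
  FiniteDimensional K L ∧ ¬ IsModeratelyRamified K L p

end Invariants

section Cosets

variable {K : Type*} [NormedField K]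

/-- `S_{a,s}(K) = {c ^ p - a c + d : |p c ^ p| < s, |d| < s}`. -/
def S (p : ℕ) (a : K) (s : ℝ) : Set K :=
  {x | ∃ c d : K, ‖(p : K) * c ^ p‖ < s ∧ ‖d‖ < s ∧ x = c ^ p - a * c + d}

/-- The coset `b + S_{a,s}(K)`. -/
def coset (p : ℕ) (b a : K) (s : ℝ) : Set K :=
  (fun x => b + x) '' S p a s

/-- `b + S_{a,s}(K)` is split if it contains zero. -/
def IsSplit (p : ℕ) (b a : K) (s : ℝ) : Prop :=
  0 ∈ coset p b a s

/-- `b + S_{a,s}(K)` is critical if it is not split and `inf |b + S_{a,s}(K)| = s > 0`. -/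
def IsCritical (p : ℕ) (b a : K) (s : ℝ) : Prop :=
  ¬ IsSplit p b a s ∧ 0 < s ∧ IsGLB ((fun y : K => ‖y‖) '' coset p b a s) s

/-- A critical coset is special if `a = 0`, or `a = 1` and `s = 1`. -/
def IsSpecial (p : ℕ) (b a : K) (s : ℝ) : Prop :=
  IsCritical p b a s ∧ (a = 0 ∨ (a = 1 ∧ s = 1))

/-- `s ∈ |b + S_{a,s}(K)|`. -/
def IsAttained (p : ℕ) (b a : K) (s : ℝ) : Prop :=
  ∃ y ∈ coset p b a s, ‖y‖ = s

/-- `s ∈ |K^×| ^ p`. -/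
def IsPthPowerValue (K : Type*) [NormedField K] (p : ℕ) (s : ℝ) : Prop :=
  ∃ c : K, c ≠ 0 ∧ s = ‖c‖ ^ p

/-- The condition: `|a| = s ^ ((p - 1) / p)` and `s ∉ |b + S_{a,s}(K)|`. -/
def IsNonattainedOfEqual (p : ℕ) (b a : K) (s : ℝ) : Prop :=
  ‖a‖ = s ^ (((p : ℝ) - 1) / (p : ℝ)) ∧ ¬ IsAttained p b a s

end Cosets

/-- `b + S_{a,s}(K)` is critical over `K`, and `b + S_{a,s}(L)` is split. -/
def IsCriticalSplitOver (K L : Type*) [NormedField K] [NormedField L] [NormedAlgebra K L]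
    (p : ℕ) (b a : K) (s : ℝ) : Prop :=
  IsCritical p b a s ∧ IsSplit p (algebraMap K L b) (algebraMap K L a) s

end

end AnalyticField

/-!
The extension `L / K` has prime degree `p`, so everything is read off from one element `z` of `L`
outside `K` and from its distance `r` to `K`. A critical coset `b + S_{a,s}(K)` which splits over
`L`, with `a` as in the two cases considered, amounts to an *approximate root*
(`IsApproximateRoot`): an element `z` at distance `r` from `K`, where `s = r ^ p`, such that
`‖z ^ p - a z + b‖ < s` and `‖p z ^ p‖ < s`. Indeed the element of the coset given by
`c` has norm `‖z - c‖ ^ p`, so that `s` is a value on the coset if and only if the distance is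
attained (`IsCriticalSplitOver.exists_isApproximateRoot`, `IsApproximateRoot.isCriticalSplitOver`,
`IsApproximateRoot.isAttained_iff`).

If the distance from `z` to `K` is not attained, the key fact is stability
(`IsUnattainedDistance.norm_hasseDeriv_mul_pow_lt`): in the Taylor expansion at `z` of a nonzero
polynomial over `K` of degree less than `p`, the constant term strictly dominates at distance `r`.
It is proved by induction on the degree through the derivative, with one Newton step inside `K`
(`IsUnattainedDistance.norm_derivative_mul_lt`). Consequently every element of `L`, being a
polynomial of degree less than `p` in `z`, is approximated by `K`, and `L / K` is immediate.
Applied to the derivative of the minimal polynomial of `z`, stability shows that near `z` all Taylor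
coefficients except those of index `0`, `1`, `p` are negligible, which produces the coset
(`IsUnattainedDistance.exists_isApproximateRoot`). It also shows that no element of degree less than
`p` over `K` comes nearer to `z` than `K` does, so the distance is still `r`, and not attained, over
`K(a ^ (1 / (p - 1)))`. Finally, if `‖a‖ = r ^ (p - 1)` then `y ↦ (y ^ p + b) / a` is a contraction
near `z`, and its fixed point is a root of `T ^ p - a T + b` (`IsApproximateRoot.exists_root`).

If the distance is attained, `z` may be replaced by some `z - c` of norm `r`. Either `r` is not a
value on `K`, and the powers of `z` have norms in distinct cosets of the value group, so that
`e = p`; or `z` can be scaled to have norm one, its residue has degree `p`, and `f = p`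
(`invariants_of_norm_notMem`, `invariants_of_natDegree_minpoly_residue`). Wildness is used only to
find a coset in this case: the residue cannot be separable of degree `p`, since then `L° / K°` would
be étale (`etale_of_separable`), so its `p`-th power lies in the residue field of `K`
(`IsDistance.exists_isApproximateRoot`).
-/

/-! ### Ultrametric estimates and the stability of polynomials of small degree -/

namespace AnalyticField

open Polynomial Filter Topology Finset

section Stability

theorem norm_natCast_eq_one_of_coprime {F : Type*} [NormedField F] [IsUltrametricDist F] {p n : ℕ}
    (hp : ‖(p : F)‖ < 1) (h : n.Coprime p) : ‖(n : F)‖ = 1 := by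
  refine le_antisymm (IsUltrametricDist.norm_natCast_le_one F n) ?_
  by_contra! hn
  have hb : ((n : ℤ) * n.gcdA p + p * n.gcdB p : ℤ) = 1 := by
    rw [← Nat.gcd_eq_gcd_ab, h]; rfl
  have hb' : (n : F) * ((n.gcdA p : ℤ) : F) + p * ((n.gcdB p : ℤ) : F) = 1 := by
    exact_mod_cast congrArg (Int.cast : ℤ → F) hb
  have h1 : ∀ m : ℤ, ‖(m : F)‖ ≤ 1 := IsUltrametricDist.norm_intCast_le_one F
  have h2 : ‖(n : F) * ((n.gcdA p : ℤ) : F) + p * ((n.gcdB p : ℤ) : F)‖ < 1 := by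
    refine (IsUltrametricDist.norm_add_le_max _ _).trans_lt (max_lt ?_ ?_) <;> rw [norm_mul]
    · exact mul_lt_one_of_nonneg_of_lt_one_left (norm_nonneg _) hn (h1 _)
    · exact mul_lt_one_of_nonneg_of_lt_one_left (norm_nonneg _) hp (h1 _)
  rw [hb', norm_one] at h2
  exact lt_irrefl _ h2

theorem norm_sum_lt {ι F : Type*} [NormedField F] [IsUltrametricDist F] (s : Finset ι) (f : ι → F)
    {B : ℝ} (hB : 0 < B) (h : ∀ i ∈ s, ‖f i‖ < B) : ‖∑ i ∈ s, f i‖ < B := by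
  rcases s.eq_empty_or_nonempty with rfl | hs
  · simpa using hB
  · obtain ⟨i, hi, hle⟩ := IsUltrametricDist.exists_norm_finsetSum_le_of_nonempty hs f
    exact hle.trans_lt (h i hi)

theorem norm_add_lt {F : Type*} [NormedField F] [IsUltrametricDist F] {x y : F} {B : ℝ}
    (hx : ‖x‖ < B) (hy : ‖y‖ < B) : ‖x + y‖ < B :=
  (IsUltrametricDist.norm_add_le_max _ _).trans_lt (max_lt hx hy)

theorem norm_sub_lt {F : Type*} [NormedField F] [IsUltrametricDist F] {x y : F} {B : ℝ}
    (hx : ‖x‖ < B) (hy : ‖y‖ < B) : ‖x - y‖ < B := by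
  rw [sub_eq_add_neg]
  exact norm_add_lt hx (by rwa [norm_neg])

/-- The dominant term determines the norm. -/
theorem norm_eq_of_norm_sub_lt {F : Type*} [NormedField F] [IsUltrametricDist F] {x y : F}
    (h : ‖x - y‖ < ‖y‖) : ‖x‖ = ‖y‖ := by
  have := IsUltrametricDist.norm_add_eq_max_of_norm_ne_norm h.ne
  rwa [sub_add_cancel, max_eq_right h.le] at this

variable {K E : Type*} [NormedField K] [NormedField E] [NormedAlgebra K E]

theorem aeval_eq_sum_hasseDeriv (g : K[X]) (x y : E) {N : ℕ} (hN : g.natDegree < N) :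
    aeval y g = ∑ j ∈ range N, aeval x (hasseDeriv j g) * (y - x) ^ j := by
  have hD : ∀ j, (hasseDeriv j (g.map (algebraMap K E))).eval x = aeval x (hasseDeriv j g) := by
    intro j
    rw [aeval_def, ← eval_map]
    congr 1
    ext n
    simp [hasseDeriv_coeff]
  have h1 : (taylor x (g.map (algebraMap K E))).eval (y - x) = aeval y g := by
    rw [taylor_eval, sub_add_cancel, eval_map_algebraMap]
  rw [← h1, eval_eq_sum_range' (n := N) (by rw [natDegree_taylor, natDegree_map]; exact hN)]
  exact Finset.sum_congr rfl fun j _ => by rw [taylor_coeff, hD]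

theorem aeval_hasseDeriv_derivative (g : K[X]) (x : E) (j : ℕ) :
    aeval x (hasseDeriv j (derivative g)) = ((j + 1 : ℕ) : E) * aeval x (hasseDeriv (j + 1) g) := by
  have h := congrArg (fun f => f g) (hasseDeriv_comp (R := K) j 1)
  simp only [LinearMap.comp_apply, hasseDeriv_one', LinearMap.smul_apply,
    Nat.choose_succ_self_right] at h
  rw [h, map_nsmul, nsmul_eq_mul]

theorem aeval_hasseDeriv_eq_zero (g : K[X]) (x : E) {j : ℕ} (h : g.natDegree < j) :
    aeval x (hasseDeriv j g) = 0 := by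
  rw [hasseDeriv_eq_zero_of_lt_natDegree _ _ h, map_zero]

/-- Taylor expansion at `x`, keeping only the terms with index in `s`: all others are small. -/
theorem norm_aeval_sub_sum_lt [IsUltrametricDist E] (s : Finset ℕ) (g : K[X]) (x y : E) {B : ℝ}
    (hB : 0 < B) (h : ∀ j ∉ s, ‖aeval x (hasseDeriv j g)‖ * ‖y - x‖ ^ j < B) :
    ‖aeval y g - ∑ j ∈ s, aeval x (hasseDeriv j g) * (y - x) ^ j‖ < B := by
  set N := max (g.natDegree + 1) (s.sup id + 1) with hN
  have hs : s ⊆ range N := fun j hj => by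
    have : j ≤ s.sup id := Finset.le_sup (f := id) hj
    rw [mem_range]; omega
  rw [aeval_eq_sum_hasseDeriv g x y (N := N) (by omega), ← Finset.sum_sdiff hs,
    add_sub_cancel_right]
  refine norm_sum_lt _ _ hB fun j hj => ?_
  rw [norm_mul, norm_pow]
  exact h j (Finset.mem_sdiff.1 hj).2

variable (K) in
/-- `r` is the distance from `x` to the subfield `K`, and it is positive. -/
structure IsDistance (x : E) (r : ℝ) : Prop where
  pos : 0 < r
  le : ∀ c : K, r ≤ ‖x - algebraMap K E c‖
  exists_lt : ∀ ρ, r < ρ → ∃ c : K, ‖x - algebraMap K E c‖ < ρ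

variable (K) in
/-- `r` is the distance from `x` to the subfield `K`, it is positive, and no element of `K`
realizes it. -/
structure IsUnattainedDistance (x : E) (r : ℝ) : Prop extends IsDistance K x r where
  lt : ∀ c : K, r < ‖x - algebraMap K E c‖

theorem IsDistance.exists_of_eventually {x : E} {r : ℝ} (hx : IsDistance K x r) {P : ℝ → Prop}
    (h : ∀ᶠ ρ in 𝓝 r, P ρ) : ∃ c : K, P ‖x - algebraMap K E c‖ := by
  obtain ⟨ε, hε, H⟩ := Metric.eventually_nhds_iff.1 h
  obtain ⟨c, hc⟩ := hx.exists_lt (r + ε) (by linarith)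
  refine ⟨c, H ?_⟩
  have := hx.le c
  rw [Real.dist_eq, abs_lt]
  constructor <;> linarith

theorem IsDistance.notMem_range {x : E} {r : ℝ} (hx : IsDistance K x r) :
    x ∉ Set.range (algebraMap K E) := by
  rintro ⟨c, rfl⟩
  have := hx.le c
  rw [sub_self, norm_zero] at this
  exact this.not_gt hx.pos

theorem IsDistance.sub_algebraMap {x : E} {r : ℝ} (hx : IsDistance K x r) (y : K) :
    IsDistance K (x - algebraMap K E y) r := by
  refine ⟨hx.pos, fun c => ?_, fun ρ hρ => ?_⟩
  · have := hx.le (y + c)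
    rwa [map_add, ← sub_sub] at this
  · obtain ⟨c, hc⟩ := hx.exists_lt ρ hρ
    refine ⟨c - y, ?_⟩
    rwa [map_sub, sub_sub_sub_cancel_right]

theorem eventually_norm_mul_pow_lt (s : Finset ℕ) (g : K[X]) (x : E) {r B : ℝ} (hB : 0 < B)
    (h : ∀ j ∉ s, ‖aeval x (hasseDeriv j g)‖ * r ^ j < B) :
    ∀ᶠ ρ in 𝓝 r, ∀ j ∉ s, ‖aeval x (hasseDeriv j g)‖ * ρ ^ j < B := by
  have h1 : ∀ᶠ ρ in 𝓝 r, ∀ j ∈ (range (g.natDegree + 1) \ s),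
      ‖aeval x (hasseDeriv j g)‖ * ρ ^ j < B := by
    rw [Filter.eventually_all_finset]
    intro j hj
    have hc : Continuous fun ρ : ℝ => ‖aeval x (hasseDeriv j g)‖ * ρ ^ j := by fun_prop
    exact hc.continuousAt.eventually (gt_mem_nhds (h j (Finset.mem_sdiff.1 hj).2))
  filter_upwards [h1] with ρ hρ j hj
  by_cases hjn : j < g.natDegree + 1
  · exact hρ j (Finset.mem_sdiff.2 ⟨mem_range.2 hjn, hj⟩)
  · rw [aeval_hasseDeriv_eq_zero g x (by omega)]
    simpa using hB

variable [IsUltrametricDist E]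

/-- If the distance from `x` to `K` is not attained and the linear Taylor coefficient of `g` at `x`
dominates the higher ones at that distance, then the constant one dominates the linear one.
Otherwise `‖g c‖ = ‖g' x‖ * ‖x - c‖` for `c` in `K` near `x`, which contradicts that one Newton step
`c ↦ c - g c / g' c`, performed inside `K`, makes `‖g c‖` smaller than `‖g' x‖ * r`. -/
theorem IsUnattainedDistance.norm_derivative_mul_lt {x : E} {r : ℝ}
    (hx : IsUnattainedDistance K x r) (g : K[X])
    (h : ∀ j, 2 ≤ j → ‖aeval x (hasseDeriv j g)‖ * r ^ j < ‖aeval x (derivative g)‖ * r) :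
    ‖aeval x (derivative g)‖ * r < ‖aeval x g‖ := by
  by_contra! hg
  set G := aeval x (derivative g) with hG
  have hr := hx.pos
  have hB : 0 < ‖G‖ * r := by
    have := h (g.natDegree + 2) (by omega)
    rwa [aeval_hasseDeriv_eq_zero g x (by omega), norm_zero, zero_mul] at this
  have hG0 : 0 < ‖G‖ := pos_of_mul_pos_left hB hr.le
  have hmem : ∀ j, j ∉ ({0, 1} : Finset ℕ) ↔ 2 ≤ j := by
    intro j; simp only [mem_insert, mem_singleton]; omega
  obtain ⟨c, hc⟩ := hx.exists_of_eventually (eventually_norm_mul_pow_lt {0, 1} g x hB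
    fun j hj => h j ((hmem j).1 hj))
  set ρ := ‖x - algebraMap K E c‖ with hρ
  have hrρ : r < ρ := hx.lt c
  -- the expansion of `g` to first order, valid at distance at most `ρ` from `x`
  have key : ∀ c' : K, ‖x - algebraMap K E c'‖ ≤ ρ →
      ‖aeval (algebraMap K E c') g - (aeval x g + G * (algebraMap K E c' - x))‖ < ‖G‖ * r := by
    intro c' hc'
    have := norm_aeval_sub_sum_lt {0, 1} g x (algebraMap K E c') hB fun j hj =>
      lt_of_le_of_lt (mul_le_mul_of_nonneg_left (pow_le_pow_left₀ (norm_nonneg _)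
        (by rwa [norm_sub_rev]) _) (norm_nonneg _)) (hc j hj)
    simpa [hasseDeriv_one'] using this
  have val : ∀ c' : K, ‖x - algebraMap K E c'‖ ≤ ρ →
      ‖aeval (algebraMap K E c') g‖ = ‖G‖ * ‖x - algebraMap K E c'‖ := by
    intro c' hc'
    have hlt : ‖G‖ * r < ‖G‖ * ‖x - algebraMap K E c'‖ := mul_lt_mul_of_pos_left (hx.lt c') hG0
    have h1 : ‖G * (algebraMap K E c' - x)‖ = ‖G‖ * ‖x - algebraMap K E c'‖ := by
      rw [norm_mul, norm_sub_rev]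
    rw [← h1]
    apply norm_eq_of_norm_sub_lt
    rw [h1]
    have : aeval (algebraMap K E c') g - G * (algebraMap K E c' - x) =
      (aeval (algebraMap K E c') g - (aeval x g + G * (algebraMap K E c' - x))) + aeval x g := by
      ring
    rw [this]
    exact norm_add_lt ((key c' hc').trans hlt) (hg.trans_lt hlt)
  -- the derivative at `c` is close to the derivative at `x`
  have hder : ‖aeval (algebraMap K E c) (derivative g) - G‖ * ρ < ‖G‖ * r := by
    have hB' : 0 < ‖G‖ * r / ρ := div_pos hB (hr.trans hrρ)
    have h1 := norm_aeval_sub_sum_lt {0} (derivative g) x (algebraMap K E c) hB' fun j hj => by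
      rw [aeval_hasseDeriv_derivative, norm_mul, lt_div_iff₀ (hr.trans hrρ), norm_sub_rev, ← hρ,
        mul_assoc, ← pow_succ, mul_assoc]
      have h2 := hc (j + 1) ((hmem _).2 (by simp at hj; omega))
      exact lt_of_le_of_lt (mul_le_of_le_one_left (by positivity)
        (IsUltrametricDist.norm_natCast_le_one E _)) h2
    rw [lt_div_iff₀ (hr.trans hrρ)] at h1
    simpa using h1
  have hder' : ‖aeval (algebraMap K E c) (derivative g)‖ = ‖G‖ := by
    apply norm_eq_of_norm_sub_lt
    have : ‖aeval (algebraMap K E c) (derivative g) - G‖ * ρ < ‖G‖ * ρ :=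
      hder.trans (mul_lt_mul_of_pos_left hrρ hG0)
    exact lt_of_mul_lt_mul_right this (hr.trans hrρ).le
  have hd0 : aeval (algebraMap K E c) (derivative g) ≠ 0 := by
    rw [← norm_pos_iff, hder']; exact hG0
  -- the Newton step
  obtain ⟨q, hq⟩ : ∃ q : K, algebraMap K E q =
      aeval (algebraMap K E c) g / aeval (algebraMap K E c) (derivative g) :=
    ⟨aeval c g / aeval c (derivative g), by
      rw [map_div₀, ← aeval_algebraMap_apply, ← aeval_algebraMap_apply]⟩
  have hqn : ‖algebraMap K E q‖ = ρ := by
    rw [hq, norm_div, hder', val c le_rfl, mul_div_cancel_left₀ _ hG0.ne']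
  have hc' : ‖x - algebraMap K E (c - q)‖ ≤ ρ := by
    rw [map_sub, show x - (algebraMap K E c - algebraMap K E q) =
      (x - algebraMap K E c) + algebraMap K E q by ring]
    exact (IsUltrametricDist.norm_add_le_max _ _).trans (max_le le_rfl hqn.le)
  have hlow : ‖G‖ * r < ‖aeval (algebraMap K E (c - q)) g‖ := by
    rw [val _ hc']; exact mul_lt_mul_of_pos_left (hx.lt _) hG0
  refine hlow.not_gt ?_
  have hid : aeval (algebraMap K E (c - q)) g =
      (aeval (algebraMap K E (c - q)) g - (aeval x g + G * (algebraMap K E (c - q) - x)))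
      - (aeval (algebraMap K E c) g - (aeval x g + G * (algebraMap K E c - x)))
      + (aeval (algebraMap K E c) (derivative g) - G) * algebraMap K E q := by
    have : aeval (algebraMap K E c) g =
        aeval (algebraMap K E c) (derivative g) * algebraMap K E q := by
      rw [hq, mul_div_cancel₀ _ hd0]
    rw [map_sub]
    linear_combination this
  rw [hid]
  refine norm_add_lt (norm_sub_lt (key _ hc') (key _ le_rfl)) ?_
  rwa [norm_mul, hqn]

/-- Stability: if the distance from `x` to `K` is not attained, then in the Taylor expansion at `x`
of a nonzero polynomial of degree less than the residue characteristic the constant term dominates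
strictly, at that distance. -/
theorem IsUnattainedDistance.norm_hasseDeriv_mul_pow_lt {p : ℕ} (hp : p.Prime)
    (hpE : ‖(p : E)‖ < 1) {x : E} {r : ℝ} (hx : IsUnattainedDistance K x r) (g : K[X]) (hg : g ≠ 0)
    (hdeg : g.natDegree < p) (j : ℕ) (hj : 1 ≤ j) :
    ‖aeval x (hasseDeriv j g)‖ * r ^ j < ‖aeval x g‖ := by
  have hr := hx.pos
  induction hn : g.natDegree generalizing g j with
  | zero =>
    obtain ⟨c, rfl⟩ := natDegree_eq_zero.1 hn
    rw [hasseDeriv_C _ _ hj]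
    have : c ≠ 0 := fun h => hg (by simp [h])
    simpa using this
  | succ n ih =>
    have hunit : ∀ m : ℕ, 0 < m → m < p → ‖(m : E)‖ = 1 := fun m h0 h1 =>
      norm_natCast_eq_one_of_coprime hpE
        ((Nat.Prime.coprime_iff_not_dvd hp).2 (Nat.not_dvd_of_pos_of_lt h0 h1)).symm
    have hlead : (derivative g).coeff n ≠ 0 := by
      rw [coeff_derivative, ← hn, coeff_natDegree]
      refine mul_ne_zero (leadingCoeff_ne_zero.2 hg) fun h0 => ?_
      have := hunit (n + 1) (by omega) (by omega)
      have h2 : algebraMap K E ((n : K) + 1) = ((n + 1 : ℕ) : E) := by simp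
      rw [← h2, h0, map_zero, norm_zero] at this
      exact zero_ne_one this
    have hd0 : derivative g ≠ 0 := fun h => hlead (by simp [h])
    have hdn : (derivative g).natDegree = n := by
      refine le_antisymm ?_ (le_natDegree_of_ne_zero hlead)
      have := natDegree_derivative_le g
      omega
    have hD : ∀ i, 2 ≤ i →
        ‖aeval x (hasseDeriv i g)‖ * r ^ i < ‖aeval x (derivative g)‖ * r := by
      intro i hi
      obtain ⟨k, rfl⟩ : ∃ k, i = k + 1 := ⟨i - 1, by omega⟩
      have h1 := ih (derivative g) hd0 (by omega) k (by omega) hdn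
      rw [pow_succ, ← mul_assoc]
      refine mul_lt_mul_of_pos_right (lt_of_le_of_lt ?_ h1) hr
      by_cases hk : k + 1 < p
      · rw [aeval_hasseDeriv_derivative, norm_mul, hunit (k + 1) (by omega) hk, one_mul]
      · rw [aeval_hasseDeriv_eq_zero g x (by omega), norm_zero, zero_mul]
        positivity
    have hfin := hx.norm_derivative_mul_lt g hD
    rcases hj.eq_or_lt with rfl | hj
    · simpa [hasseDeriv_one'] using hfin
    · exact (hD j hj).trans hfin

/-- Nonzero polynomials of degree less than the residue characteristic do not vanish at `x`, and
their value at `x` is approximated by their values at elements of `K`. -/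
theorem IsUnattainedDistance.exists_norm_aeval_sub_lt {p : ℕ} (hp : p.Prime)
    (hpE : ‖(p : E)‖ < 1) {x : E} {r : ℝ} (hx : IsUnattainedDistance K x r) (g : K[X]) (hg : g ≠ 0)
    (hdeg : g.natDegree < p) : ∃ c : K, ‖aeval x g - algebraMap K E c‖ < ‖aeval x g‖ := by
  have hst := hx.norm_hasseDeriv_mul_pow_lt hp hpE g hg hdeg
  have hpos : 0 < ‖aeval x g‖ := lt_of_le_of_lt (by have := hx.pos; positivity) (hst 1 le_rfl)
  obtain ⟨c, hc⟩ := hx.exists_of_eventually (eventually_norm_mul_pow_lt {0} g x hpos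
    fun j hj => hst j (by simp at hj; omega))
  refine ⟨aeval c g, ?_⟩
  have := norm_aeval_sub_sum_lt {0} g x (algebraMap K E c) hpos
    fun j hj => by rw [norm_sub_rev]; exact hc j hj
  rw [norm_sub_rev, ← aeval_algebraMap_apply]
  simpa using this

/-- Elements algebraic of degree less than the residue characteristic do not come closer to `x`
than the elements of `K` do. -/
theorem IsUnattainedDistance.lt_norm_sub_of_natDegree_lt {p : ℕ} (hp : p.Prime)
    (hpE : ‖(p : E)‖ < 1) {x : E} {r : ℝ} (hx : IsUnattainedDistance K x r) {y : E} (g : K[X])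
    (hg : g ≠ 0) (hdeg : g.natDegree < p) (hy : aeval y g = 0) : r < ‖x - y‖ := by
  by_contra! hle
  have hst := hx.norm_hasseDeriv_mul_pow_lt hp hpE g hg hdeg
  have hpos : 0 < ‖aeval x g‖ := lt_of_le_of_lt (by have := hx.pos; positivity) (hst 1 le_rfl)
  have := norm_aeval_sub_sum_lt {0} g x y hpos fun j hj =>
    lt_of_le_of_lt (mul_le_mul_of_nonneg_left (pow_le_pow_left₀ (norm_nonneg _)
        (by rwa [norm_sub_rev]) _) (norm_nonneg _)) (hst j (by simp at hj; omega))
  simp [hy] at this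

end Stability

end AnalyticField

/-! ### Critical cosets and approximate roots -/

namespace AnalyticField

open Polynomial Filter Topology Finset

section Cosets

theorem norm_add_pow_sub_le {F : Type*} [NormedField F] [IsUltrametricDist F] {p : ℕ}
    (hp : p.Prime) {x y : F} {M : ℝ} (hx : ‖x‖ ≤ M) (hy : ‖y‖ ≤ M) :
    ‖(x + y) ^ p - x ^ p - y ^ p‖ ≤ ‖(p : F)‖ * ‖x‖ * M ^ (p - 1) := by
  have hM : 0 ≤ M := (norm_nonneg x).trans hx
  rw [(Commute.all x y).add_pow_prime_eq hp, add_sub_right_comm, add_sub_cancel_left,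
    add_sub_cancel_left, Finset.mul_sum]
  refine IsUltrametricDist.norm_sum_le_of_forall_le_of_nonneg (by positivity) fun k hk => ?_
  rw [Finset.mem_Ioo] at hk
  simp only [norm_mul, norm_pow]
  calc ‖(p : F)‖ * ‖x‖ * ‖y‖ * (‖x‖ ^ (k - 1) * ‖y‖ ^ (p - k - 1) * ‖((p.choose k / p : ℕ) : F)‖)
      ≤ ‖(p : F)‖ * ‖x‖ * M * (M ^ (k - 1) * M ^ (p - k - 1) * 1) := by
        gcongr
        exact IsUltrametricDist.norm_natCast_le_one F _
    _ = ‖(p : F)‖ * ‖x‖ * (M ^ (1 + (k - 1) + (p - k - 1))) := by ring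
    _ = ‖(p : F)‖ * ‖x‖ * M ^ (p - 1) := by congr 2; omega

/-- `T ↦ T ^ p` is additive up to a small error where `‖p * T ^ p‖` is small. -/
theorem norm_add_pow_sub_lt {F : Type*} [NormedField F] [IsUltrametricDist F] {p : ℕ}
    (hp : p.Prime) {x y : F} {s : ℝ} (hx : ‖(p : F) * x ^ p‖ < s) (hy : ‖(p : F) * y ^ p‖ < s) :
    ‖(x + y) ^ p - x ^ p - y ^ p‖ < s := by
  refine (norm_add_pow_sub_le hp (le_max_left ‖x‖ ‖y‖) (le_max_right _ _)).trans_lt ?_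
  rw [mul_assoc]
  have h : ‖x‖ * max ‖x‖ ‖y‖ ^ (p - 1) ≤ max ‖x‖ ‖y‖ ^ p := by
    conv_rhs => rw [← Nat.sub_one_add_one hp.ne_zero, pow_succ']
    gcongr
    exact le_max_left _ _
  refine (mul_le_mul_of_nonneg_left h (norm_nonneg _)).trans_lt ?_
  rw [norm_mul, norm_pow] at hx hy
  rcases max_choice ‖x‖ ‖y‖ with h | h <;> rwa [h]

theorem norm_mul_sub_pow_lt {F : Type*} [NormedField F] [IsUltrametricDist F] {p : ℕ}
    {x y : F} {s : ℝ} (hx : ‖(p : F) * x ^ p‖ < s) (hy : ‖(p : F) * y ^ p‖ < s) :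
    ‖(p : F) * (x - y) ^ p‖ < s := by
  have h : ‖x - y‖ ≤ max ‖x‖ ‖y‖ := by
    have := IsUltrametricDist.norm_add_le_max x (-y)
    rwa [norm_neg, ← sub_eq_add_neg] at this
  rw [norm_mul, norm_pow] at *
  refine lt_of_le_of_lt (mul_le_mul_of_nonneg_left (pow_le_pow_left₀ (norm_nonneg _) h _)
    (norm_nonneg _)) ?_
  rcases le_total ‖x‖ ‖y‖ with h | h
  · rwa [max_eq_right h]
  · rwa [max_eq_left h]

theorem norm_sub_pow_sub_lt {F : Type*} [NormedField F] [IsUltrametricDist F] {p : ℕ}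
    (hp : p.Prime) {x y : F} {s : ℝ} (hx : ‖(p : F) * x ^ p‖ < s) (hy : ‖(p : F) * y ^ p‖ < s) :
    ‖(x - y) ^ p - (x ^ p - y ^ p)‖ < s := by
  have := norm_add_pow_sub_lt hp (norm_mul_sub_pow_lt hx hy) hy
  rw [sub_add_cancel] at this
  rw [← norm_neg]
  rwa [show -((x - y) ^ p - (x ^ p - y ^ p)) = x ^ p - (x - y) ^ p - y ^ p by ring]

theorem pow_rpow_sub_one_div {p : ℕ} (hp : p.Prime) {r : ℝ} (hr : 0 ≤ r) :
    (r ^ p) ^ (((p : ℝ) - 1) / (p : ℝ)) = r ^ (p - 1) := by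
  have hp0 : (p : ℝ) ≠ 0 := by exact_mod_cast hp.ne_zero
  rw [← Real.rpow_natCast, ← Real.rpow_mul hr, mul_div_cancel₀ _ hp0, ← Real.rpow_natCast,
    Nat.cast_sub hp.one_le, Nat.cast_one]

variable {K L : Type*} [NormedField K] [NormedField L] [NormedAlgebra K L]

/-- `z` is, up to an error of norm less than `r ^ p`, a root of `T ^ p - a T + b`, and it lies at
distance `r` from `K`; moreover either `a = 0`, or `‖a‖ = r ^ (p - 1)` and the distance is not
attained. The bound on `p * z ^ p` makes `T ↦ T ^ p` additive up to errors of norm less than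
`r ^ p`. -/
structure IsApproximateRoot (p : ℕ) (b a : K) (z : L) (r : ℝ) : Prop where
  isDistance : IsDistance K z r
  norm_mul_pow_lt : ‖(p : L) * z ^ p‖ < r ^ p
  norm_lt : ‖z ^ p - algebraMap K L a * z + algebraMap K L b‖ < r ^ p
  alternative : a = 0 ∨ (‖a‖ = r ^ (p - 1) ∧ ∀ c : K, r < ‖z - algebraMap K L c‖)

theorem norm_pow_sub_mul [IsUltrametricDist L] {p : ℕ} (hp : p.Prime) {a : K} {w : L} {r : ℝ}
    (hr : 0 < r)
    (h : a = 0 ∨ (‖a‖ = r ^ (p - 1) ∧ r < ‖w‖)) : ‖w ^ p - algebraMap K L a * w‖ = ‖w‖ ^ p := by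
  rcases h with rfl | ⟨ha, hw⟩
  · simp
  · rw [← norm_pow]
    apply norm_eq_of_norm_sub_lt
    rw [sub_sub_cancel_left, norm_neg, norm_mul, norm_pow, norm_algebraMap', ha]
    obtain ⟨k, rfl⟩ : ∃ k, p = k + 1 := ⟨p - 1, by have := hp.pos; omega⟩
    have hk : k ≠ 0 := by rintro rfl; exact Nat.not_prime_one hp
    rw [pow_succ, Nat.add_sub_cancel]
    exact mul_lt_mul_of_pos_right (pow_lt_pow_left₀ hw hr.le hk) (hr.trans hw)

variable [IsUltrametricDist L]

/-- The values on the coset `b + S_{a,s}(K)`, compared with those of `T ^ p - a T` at the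
difference to the point `z` over which the coset splits. -/
theorem norm_coset_sub_lt {p : ℕ} (hp : p.Prime) {b a c d : K} {z : L} {s : ℝ}
    (hz : ‖(p : L) * z ^ p‖ < s) (hb : ‖z ^ p - algebraMap K L a * z + algebraMap K L b‖ < s)
    (hc : ‖(p : K) * c ^ p‖ < s) (hd : ‖d‖ < s) :
    ‖algebraMap K L (b + (c ^ p - a * c + d)) -
      ((algebraMap K L c - z) ^ p - algebraMap K L a * (algebraMap K L c - z))‖ < s := by
  have hc' : ‖(p : L) * algebraMap K L c ^ p‖ < s := by
    rw [← norm_algebraMap' L] at hc; simpa using hc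
  have h1 := norm_sub_pow_sub_lt hp hc' hz
  have hd' : ‖algebraMap K L d‖ < s := by rwa [norm_algebraMap']
  have := norm_sub_lt (norm_add_lt hb hd') h1
  convert this using 2
  simp only [map_add, map_sub, map_mul, map_pow]
  ring

namespace IsApproximateRoot

variable {p : ℕ} {b a : K} {z : L} {r : ℝ}

/-- The element of the coset given by `c` has norm `‖z - c‖ ^ p`. -/
theorem norm_coset (hp : p.Prime) (h : IsApproximateRoot p b a z r) {c d : K}
    (hc : ‖(p : K) * c ^ p‖ < r ^ p) (hd : ‖d‖ < r ^ p) :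
    ‖b + (c ^ p - a * c + d)‖ = ‖z - algebraMap K L c‖ ^ p := by
  have hr := h.isDistance.pos
  have hle : r ≤ ‖algebraMap K L c - z‖ := by
    rw [norm_sub_rev]; exact h.isDistance.le c
  have h1 : ‖(algebraMap K L c - z) ^ p - algebraMap K L a * (algebraMap K L c - z)‖ =
      ‖algebraMap K L c - z‖ ^ p :=
    norm_pow_sub_mul hp hr (h.alternative.imp id fun h' => ⟨h'.1, by
      rw [norm_sub_rev]; exact h'.2 c⟩)
  rw [← norm_algebraMap' L, norm_sub_rev z, ← h1]
  apply norm_eq_of_norm_sub_lt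
  rw [h1]
  exact (norm_coset_sub_lt hp h.norm_mul_pow_lt h.norm_lt hc hd).trans_le
    (pow_le_pow_left₀ hr.le hle p)

theorem norm_mul_pow_lt_of_norm_sub {z : L} (hz : ‖(p : L) * z ^ p‖ < r) {c : K}
    (hc : ‖(p : L)‖ * ‖z - algebraMap K L c‖ ^ p < r) : ‖(p : K) * c ^ p‖ < r := by
  rw [← norm_pow, ← norm_mul] at hc
  have := norm_mul_sub_pow_lt hz hc
  rw [sub_sub_cancel] at this
  rw [← norm_algebraMap' L]
  simpa using this

theorem isAttained_iff (hp : p.Prime) (hpL : ‖(p : L)‖ < 1) (h : IsApproximateRoot p b a z r) :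
    IsAttained p b a (r ^ p) ↔ ∃ c : K, ‖z - algebraMap K L c‖ = r := by
  have hr := h.isDistance.pos
  constructor
  · rintro ⟨_, ⟨x, ⟨c, d, hc, hd, rfl⟩, rfl⟩, hy⟩
    refine ⟨c, ?_⟩
    dsimp only at hy
    rw [h.norm_coset hp hc hd] at hy
    exact (pow_left_inj₀ (norm_nonneg _) hr.le hp.ne_zero).1 hy
  · rintro ⟨c, hc⟩
    have h1 : ‖(p : K) * c ^ p‖ < r ^ p := norm_mul_pow_lt_of_norm_sub h.norm_mul_pow_lt (by
      rw [hc]; exact mul_lt_of_lt_one_left (pow_pos hr p) hpL)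
    have h0 : ‖(0 : K)‖ < r ^ p := by rw [norm_zero]; exact pow_pos hr p
    exact ⟨b + (c ^ p - a * c + 0), ⟨_, ⟨c, 0, h1, h0, rfl⟩, rfl⟩, by rw [h.norm_coset hp h1 h0, hc]⟩

theorem isCriticalSplitOver (hp : p.Prime) (hpL : ‖(p : L)‖ < 1)
    (h : IsApproximateRoot p b a z r) : IsCriticalSplitOver K L p b a (r ^ p) := by
  have hr := h.isDistance.pos
  have hrp := pow_pos hr p
  have h0 : ‖(0 : K)‖ < r ^ p := by rwa [norm_zero]
  refine ⟨⟨?_, hrp, ?_, ?_⟩, ?_⟩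
  · rintro ⟨x, ⟨c, d, hc, hd, rfl⟩, hy⟩
    dsimp only at hy
    have h1 := h.norm_coset hp hc hd
    rw [hy, norm_zero] at h1
    exact (pow_pos (hr.trans_le (h.isDistance.le c)) p).ne h1
  · rintro _ ⟨_, ⟨x, ⟨c, d, hc, hd, rfl⟩, rfl⟩, rfl⟩
    dsimp only
    rw [h.norm_coset hp hc hd]
    exact pow_le_pow_left₀ hr.le (h.isDistance.le c) p
  · intro m hm
    by_contra! hlt
    have e1 : ∀ᶠ ρ in 𝓝 r, ρ ^ p < m :=
      (continuous_pow p).continuousAt.eventually (gt_mem_nhds hlt)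
    have e2 : ∀ᶠ ρ in 𝓝 r, ‖(p : L)‖ * ρ ^ p < r ^ p := by
      have hc : Continuous fun ρ : ℝ => ‖(p : L)‖ * ρ ^ p := by fun_prop
      exact hc.continuousAt.eventually (gt_mem_nhds (mul_lt_of_lt_one_left hrp hpL))
    obtain ⟨c, hc1, hc2⟩ := h.isDistance.exists_of_eventually (e1.and e2)
    have hc := norm_mul_pow_lt_of_norm_sub h.norm_mul_pow_lt hc2
    have := hm ⟨_, ⟨_, ⟨c, 0, hc, h0, rfl⟩, rfl⟩, rfl⟩
    dsimp only at this
    rw [h.norm_coset hp hc h0] at this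
    exact this.not_gt hc1
  · refine ⟨_, ⟨z, -(z ^ p - algebraMap K L a * z + algebraMap K L b), h.norm_mul_pow_lt, ?_, rfl⟩,
      ?_⟩
    · rw [norm_neg]; exact h.norm_lt
    · dsimp only; ring

end IsApproximateRoot

/-- A critical coset which splits over `L` comes from an approximate root in `L`. -/
theorem IsCriticalSplitOver.exists_isApproximateRoot {p : ℕ} (hp : p.Prime) (hpL : ‖(p : L)‖ < 1)
    {b a : K} {s : ℝ} (h : IsCriticalSplitOver K L p b a s)
    (ha : a = 0 ∨ IsNonattainedOfEqual p b a s) :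
    ∃ (z : L) (r : ℝ), s = r ^ p ∧ IsApproximateRoot p b a z r := by
  obtain ⟨⟨hns, hs, hglb⟩, _, ⟨z, d, hz, hd, rfl⟩, h0⟩ := h
  dsimp only at h0
  have hp0 : (p : ℝ) ≠ 0 := by exact_mod_cast hp.ne_zero
  obtain ⟨r, hr, rfl⟩ : ∃ r : ℝ, 0 < r ∧ s = r ^ p := ⟨s ^ (p : ℝ)⁻¹, by positivity, by
    rw [← Real.rpow_natCast, ← Real.rpow_mul hs.le, inv_mul_cancel₀ hp0, Real.rpow_one]⟩
  have hb : ‖z ^ p - algebraMap K L a * z + algebraMap K L b‖ < r ^ p := by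
    rw [show z ^ p - algebraMap K L a * z + algebraMap K L b = -d by linear_combination h0, norm_neg]
    exact hd
  have ha' : a = 0 ∨ ‖a‖ = r ^ (p - 1) ∧ ¬ IsAttained p b a (r ^ p) :=
    ha.imp id fun h => ⟨by rw [h.1, pow_rpow_sub_one_div hp hr.le], h.2⟩
  have hz0 : ‖(0 : K)‖ < r ^ p := by rwa [norm_zero]
  -- if `‖z - c‖ ≤ r`, the main term at `c` has norm exactly `r ^ p`: were it smaller, the coset would
  -- contain an element of norm less than `r ^ p`, and hence zero
  have hval : ∀ c : K, ‖z - algebraMap K L c‖ ≤ r → ‖(p : K) * c ^ p‖ < r ^ p ∧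
      ‖(algebraMap K L c - z) ^ p - algebraMap K L a * (algebraMap K L c - z)‖ = r ^ p := by
    intro c hc
    have hpc : ‖(p : K) * c ^ p‖ < r ^ p := by
      refine IsApproximateRoot.norm_mul_pow_lt_of_norm_sub hz ?_
      refine lt_of_le_of_lt (mul_le_mul_of_nonneg_left (pow_le_pow_left₀ (norm_nonneg _) hc p)
        (norm_nonneg _)) (mul_lt_of_lt_one_left (pow_pos hr p) hpL)
    refine ⟨hpc, ?_⟩
    have hcl := norm_coset_sub_lt hp hz hb hpc hz0
    set w := algebraMap K L c - z with hw
    rw [norm_sub_rev] at hc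
    have hle : ‖w ^ p - algebraMap K L a * w‖ ≤ r ^ p := by
      rw [sub_eq_add_neg]
      refine (IsUltrametricDist.norm_add_le_max _ _).trans (max_le ?_ ?_)
      · rw [norm_pow]; exact pow_le_pow_left₀ (norm_nonneg _) hc p
      · rw [norm_neg, norm_mul, norm_algebraMap']
        rcases ha' with rfl | ⟨h1, -⟩
        · simp; positivity
        · rw [h1, ← Nat.sub_one_add_one hp.ne_zero, pow_succ, Nat.add_sub_cancel]
          exact mul_le_mul_of_nonneg_left hc (by positivity)
    refine hle.antisymm (not_lt.1 fun hlt => hns ?_)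
    have hy : ‖b + (c ^ p - a * c + 0)‖ < r ^ p := by
      rw [← norm_algebraMap' L]
      have := norm_add_lt hcl hlt
      rwa [sub_add_cancel] at this
    exact ⟨_, ⟨c, -(b + (c ^ p - a * c + 0)), hpc, by rwa [norm_neg], rfl⟩, by dsimp only; ring⟩
  have hle : ∀ c : K, r ≤ ‖z - algebraMap K L c‖ := by
    intro c
    by_contra! hlt
    have h1 := (hval c hlt.le).2
    refine h1.not_lt ?_
    rw [norm_sub_rev] at hlt
    refine norm_sub_lt ?_ ?_
    · rw [norm_pow]; exact pow_lt_pow_left₀ hlt (norm_nonneg _) hp.ne_zero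
    · rw [norm_mul, norm_algebraMap']
      rcases ha' with rfl | ⟨h2, -⟩
      · simpa using pow_pos hr p
      · rw [h2]
        calc r ^ (p - 1) * _ < r ^ (p - 1) * r := mul_lt_mul_of_pos_left hlt (by positivity)
          _ = r ^ p := by rw [← pow_succ, Nat.sub_one_add_one hp.ne_zero]
  have hun : a = 0 ∨ (‖a‖ = r ^ (p - 1) ∧ ∀ c : K, r < ‖z - algebraMap K L c‖) := by
    refine ha'.imp id fun ⟨h1, h2⟩ => ⟨h1, fun c => (hle c).lt_of_ne fun heq => h2 ?_⟩
    obtain ⟨hpc, hv⟩ := hval c heq.ge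
    refine ⟨b + (c ^ p - a * c + 0), ⟨_, ⟨c, 0, hpc, hz0, rfl⟩, rfl⟩, ?_⟩
    rw [← norm_algebraMap' L, ← hv]
    apply norm_eq_of_norm_sub_lt
    rw [hv]
    exact norm_coset_sub_lt hp hz hb hpc hz0
  refine ⟨z, r, rfl, ⟨hr, hle, fun ρ hρ => ?_⟩, hz, hb, hun⟩
  obtain ⟨_, ⟨_, ⟨_, ⟨c, d', hc, hd', rfl⟩, rfl⟩, rfl⟩, hlt⟩ :=
    (isGLB_lt_iff hglb).1 (pow_lt_pow_left₀ hρ hr.le hp.ne_zero)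
  refine ⟨c, lt_of_pow_lt_pow_left₀ p (hr.trans hρ).le ?_⟩
  dsimp only at hlt
  have h1 : ‖(algebraMap K L c - z) ^ p - algebraMap K L a * (algebraMap K L c - z)‖ =
      ‖algebraMap K L c - z‖ ^ p :=
    norm_pow_sub_mul hp hr (hun.imp id fun h' => ⟨h'.1, by rw [norm_sub_rev]; exact h'.2 c⟩)
  have h2 := norm_coset_sub_lt hp hz hb hc hd'
  rw [norm_sub_rev z, ← h1]
  have h3 := norm_sub_lt (x := algebraMap K L (b + (c ^ p - a * c + d')))
    (by rw [norm_algebraMap']; exact hlt) (h2.trans (pow_lt_pow_left₀ hρ hr.le hp.ne_zero))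
  rwa [sub_sub_cancel] at h3

/-- An element of degree `p` whose distance to `K` is not attained can be translated by `K` to an
approximate root: in the Taylor expansion of its minimal polynomial at a good approximation in `K`,
the coefficients of index strictly between `1` and `p` are negligible. -/
theorem IsUnattainedDistance.exists_isApproximateRoot {p : ℕ} (hp : p.Prime) (hpL : ‖(p : L)‖ < 1)
    {x : L} {r : ℝ} (hx : IsUnattainedDistance K x r) (P : K[X]) (hP : P.Monic)
    (hdeg : P.natDegree = p) (hPx : aeval x P = 0) :
    ∃ (b a : K) (z : L), IsApproximateRoot p b a z r ∧ ∀ c : K, r < ‖z - algebraMap K L c‖ := by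
  have hr := hx.pos
  have hrp := pow_pos hr p
  have h2p := hp.two_le
  have hlead : aeval x (hasseDeriv p P) = 1 := by
    rw [← hdeg, hasseDeriv_natDegree_eq_C, hP.leadingCoeff, map_one, map_one]
  have hunit : ∀ m : ℕ, 0 < m → m < p → ‖(m : L)‖ = 1 := fun m h0 h1 =>
    norm_natCast_eq_one_of_coprime hpL
      ((Nat.Prime.coprime_iff_not_dvd hp).2 (Nat.not_dvd_of_pos_of_lt h0 h1)).symm
  have hshift : ∀ j, 2 ≤ j → j < p →
      ‖aeval x (hasseDeriv (j - 1) (derivative P))‖ = ‖aeval x (hasseDeriv j P)‖ := by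
    intro j h2 hj
    rw [aeval_hasseDeriv_derivative, norm_mul, Nat.sub_add_cancel (by omega), hunit j (by omega) hj,
      one_mul]
  have hsplit : ∀ j, r ^ j = r ^ (j - 1) * r ∨ j = 0 := by
    intro j
    rcases j with _ | j
    · exact Or.inr rfl
    · exact Or.inl (by rw [Nat.add_sub_cancel, pow_succ])
  -- stability, applied to the derivative of `P`
  have hst : derivative P ≠ 0 → ∀ j, 2 ≤ j → j < p →
      ‖aeval x (hasseDeriv j P)‖ * r ^ j < ‖aeval x (derivative P)‖ * r := by
    intro hd j h2 hj
    have h1 := hx.norm_hasseDeriv_mul_pow_lt hp hpL (derivative P) hd (by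
      have := natDegree_derivative_lt (p := P) (by omega); omega) (j - 1) (by omega)
    rw [hshift j h2 hj] at h1
    rw [(hsplit j).resolve_right (by omega), ← mul_assoc]
    exact mul_lt_mul_of_pos_right h1 hr
  -- otherwise the linear coefficient of `P` would dominate at `x`, and `P` would not vanish there
  have hone : ‖aeval x (derivative P)‖ * r ≤ r ^ p := by
    by_contra! hlt
    have hd : derivative P ≠ 0 := by
      rintro h; rw [h, map_zero, norm_zero, zero_mul] at hlt; exact hlt.not_gt hrp
    have := hx.norm_derivative_mul_lt P fun j hj => by
      rcases lt_trichotomy j p with h | rfl | h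
      · exact hst hd j hj h
      · rwa [hlead, norm_one, one_mul]
      · rw [aeval_hasseDeriv_eq_zero P x (by omega), norm_zero, zero_mul]
        exact hrp.trans hlt
    rw [hPx, norm_zero] at this
    exact this.not_ge (by positivity)
  have hmid : ∀ j, 2 ≤ j → j ≠ p → ‖aeval x (hasseDeriv j P)‖ * r ^ j < r ^ p := by
    intro j h2 hj
    by_cases h : p < j
    · rw [aeval_hasseDeriv_eq_zero P x (by omega), norm_zero, zero_mul]; exact hrp
    by_cases hd : derivative P = 0
    · rw [← hshift j h2 (by omega), hd]; simpa using hrp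
    · exact (hst hd j h2 (by omega)).trans_le hone
  have hmem : ∀ j, j ∉ ({0, 1, p} : Finset ℕ) ↔ 2 ≤ j ∧ j ≠ p := by
    intro j; simp only [mem_insert, mem_singleton]; omega
  have e1 := eventually_norm_mul_pow_lt {0, 1, p} P x hrp
    fun j hj => hmid j ((hmem j).1 hj).1 ((hmem j).1 hj).2
  have e2 : ∀ᶠ ρ in 𝓝 r, ‖(p : L)‖ * ρ ^ p < r ^ p := by
    have hc : Continuous fun ρ : ℝ => ‖(p : L)‖ * ρ ^ p := by fun_prop
    exact hc.continuousAt.eventually (gt_mem_nhds (mul_lt_of_lt_one_left hrp hpL))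
  have e3 : ∀ᶠ ρ in 𝓝 r, ‖aeval x (derivative P)‖ * r < r ^ p →
      ‖aeval x (derivative P)‖ * ρ < r ^ p := by
    by_cases h : ‖aeval x (derivative P)‖ * r < r ^ p
    · have hc : Continuous fun ρ : ℝ => ‖aeval x (derivative P)‖ * ρ := by fun_prop
      filter_upwards [hc.continuousAt.eventually (gt_mem_nhds h)] with ρ h1 _ using h1
    · exact Eventually.of_forall fun ρ h' => absurd h' h
  obtain ⟨y, hy1, hy2, hy3⟩ := hx.exists_of_eventually (e1.and (e2.and e3))
  set ρ := ‖x - algebraMap K L y‖ with hρ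
  have hrρ : r < ρ := hx.lt y
  have hρ0 := hr.trans hrρ
  set z := x - algebraMap K L y with hz
  have hzy : algebraMap K L y - x = -z := by rw [hz]; ring
  have hpz : ‖(p : L) * z ^ p‖ < r ^ p := by rwa [norm_mul, norm_pow]
  have hlt : ∀ c : K, r < ‖z - algebraMap K L c‖ := by
    intro c
    have := hx.lt (y + c)
    rwa [map_add, ← sub_sub] at this
  have hdist : IsDistance K z r := hx.toIsDistance.sub_algebraMap y
  -- the expansion of `P` at `x`, evaluated at `y`
  have hexp : ‖aeval (algebraMap K L y) P + aeval x (derivative P) * z + z ^ p‖ < r ^ p := by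
    have h1 := norm_aeval_sub_sum_lt {0, 1, p} P x (algebraMap K L y) hrp fun j hj => by
      rw [norm_sub_rev]; exact hy1 j hj
    have h01 : (0 : ℕ) ∉ ({1, p} : Finset ℕ) := by simp; omega
    have h1p : (1 : ℕ) ∉ ({p} : Finset ℕ) := by simp; omega
    rw [sum_insert h01, sum_insert h1p, sum_singleton, hasseDeriv_zero', hPx, hlead,
      hasseDeriv_one', hzy] at h1
    have h0 : ‖(p : L) * (0 : L) ^ p‖ < r ^ p := by simpa [hp.ne_zero] using hrp
    have h2 := norm_sub_pow_sub_lt hp h0 hpz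
    rw [zero_sub, zero_pow hp.ne_zero] at h2
    convert norm_add_lt h1 h2 using 2
    ring
  have hder : ‖(aeval (algebraMap K L y) (derivative P) - aeval x (derivative P)) * z‖ < r ^ p := by
    rw [norm_mul, ← hρ, ← lt_div_iff₀ hρ0]
    have := norm_aeval_sub_sum_lt {0} (derivative P) x (algebraMap K L y) (div_pos hrp hρ0)
      fun j hj => by
        have hj0 : j ≠ 0 := by simpa using hj
        rw [aeval_hasseDeriv_derivative, norm_mul, lt_div_iff₀ hρ0, norm_sub_rev, ← hρ, mul_assoc,
          mul_assoc, ← pow_succ]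
        by_cases hjp : j + 1 = p
        · rw [hjp, hlead, norm_one, one_mul]; exact hy2
        · exact (mul_le_of_le_one_left (by positivity)
            (IsUltrametricDist.norm_natCast_le_one L _)).trans_lt
            (hy1 (j + 1) ((hmem _).2 ⟨by omega, hjp⟩))
    simpa using this
  rcases hone.lt_or_eq with h | h
  · refine ⟨aeval y P, 0, z, ⟨hdist, hpz, ?_, Or.inl rfl⟩, hlt⟩
    have h1 : ‖aeval x (derivative P) * z‖ < r ^ p := by rw [norm_mul]; exact hy3 h
    convert norm_sub_lt hexp h1 using 2
    rw [aeval_algebraMap_apply]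
    simp only [map_zero]
    ring
  · refine ⟨aeval y P, -aeval y (derivative P), z, ⟨hdist, hpz, ?_, Or.inr ⟨?_, hlt⟩⟩, hlt⟩
    · convert norm_add_lt hexp hder using 2
      rw [map_neg, ← aeval_algebraMap_apply, ← aeval_algebraMap_apply]
      ring
    · have hG : ‖aeval x (derivative P)‖ = r ^ (p - 1) := by
        have : r ^ p = r ^ (p - 1) * r := (hsplit p).resolve_right hp.ne_zero
        rw [this] at h
        exact mul_right_cancel₀ hr.ne' h
      rw [norm_neg, ← norm_algebraMap' L, ← aeval_algebraMap_apply, ← hG]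
      apply norm_eq_of_norm_sub_lt
      rw [norm_mul, ← hρ, ← h] at hder
      have hpos : 0 < ‖aeval x (derivative P)‖ := by rw [hG]; positivity
      exact lt_of_mul_lt_mul_right (hder.trans (mul_lt_mul_of_pos_left hrρ hpos)) hρ0.le

end Cosets

end AnalyticField

/-! ### Residue fields, value groups and their invariants -/

namespace AnalyticField

open Polynomial IsLocalRing Finset

section Integers

variable {K : Type*} [NormedField K] [IsUltrametricDist K]

theorem mem_integers {x : K} : x ∈ Integers K ↔ ‖x‖ ≤ 1 := by
  rw [Valuation.mem_valuationSubring_iff, NormedField.valuation_apply]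
  exact Iff.rfl

theorem isUnit_integers_iff {x : Integers K} : IsUnit x ↔ ‖(x : K)‖ = 1 := by
  constructor
  · rintro ⟨u, rfl⟩
    refine le_antisymm (mem_integers.1 u.1.2) ?_
    have h1 : ((u⁻¹ : (Integers K)ˣ) : Integers K) * (u : Integers K) = 1 := u.inv_mul
    have h2 : ‖((((u⁻¹ : (Integers K)ˣ) : Integers K)) : K)‖ * ‖((u : Integers K) : K)‖ = 1 := by
      rw [← norm_mul, ← norm_one (α := K)]
      exact congrArg norm (congrArg Subtype.val h1)
    calc 1 = _ := h2.symm
      _ ≤ 1 * ‖((u : Integers K) : K)‖ :=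
        mul_le_mul_of_nonneg_right (mem_integers.1 (Subtype.prop _)) (norm_nonneg _)
      _ = _ := one_mul _
  · intro h
    have h0 : (x : K) ≠ 0 := by rw [← norm_pos_iff, h]; exact one_pos
    refine IsUnit.of_mul_eq_one ⟨(x : K)⁻¹, mem_integers.2 (by rw [norm_inv, h, inv_one])⟩ ?_
    exact Subtype.ext (mul_inv_cancel₀ h0)

theorem residue_eq_zero_iff_norm_lt {x : Integers K} :
    residue (Integers K) x = 0 ↔ ‖(x : K)‖ < 1 := by
  rw [residue_eq_zero_iff, mem_maximalIdeal, mem_nonunits_iff, isUnit_integers_iff]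
  exact ⟨fun h => lt_of_le_of_ne (mem_integers.1 x.2) h, fun h => h.ne⟩

theorem residue_eq_residue_iff {x y : Integers K} :
    residue (Integers K) x = residue (Integers K) y ↔ ‖(x : K) - y‖ < 1 := by
  rw [← sub_eq_zero, ← map_sub, residue_eq_zero_iff_norm_lt]
  rfl

theorem norm_natCast_lt_one (p : ℕ) [CharP (Residue K) p] : ‖(p : K)‖ < 1 := by
  have h : residue (Integers K) (p : Integers K) = 0 := by
    rw [map_natCast]; exact CharP.cast_eq_zero _ p
  simpa using residue_eq_zero_iff_norm_lt.1 h

/-- A nonzero polynomial is a constant times an integral polynomial with nonzero reduction. -/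
theorem exists_eq_C_mul_map (g : K[X]) (hg : g ≠ 0) :
    ∃ (c : K) (G : (Integers K)[X]), c ≠ 0 ∧ G.natDegree = g.natDegree ∧
      g = C c * G.map (algebraMap (Integers K) K) ∧ G.map (residue (Integers K)) ≠ 0 := by
  obtain ⟨i, hi, hmax⟩ := g.support.exists_max_image (fun i => ‖g.coeff i‖)
    (nonempty_support_iff.2 hg)
  have hi0 : g.coeff i ≠ 0 := mem_support_iff.1 hi
  have hle : ∀ j, ‖(g.coeff i)⁻¹ * g.coeff j‖ ≤ 1 := by
    intro j
    rw [norm_mul, norm_inv, inv_mul_le_iff₀ (norm_pos_iff.2 hi0), mul_one]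
    by_cases hj : j ∈ g.support
    · exact hmax j hj
    · rw [notMem_support_iff.1 hj, norm_zero]; exact norm_nonneg _
  have hl : C (g.coeff i)⁻¹ * g ∈ lifts (algebraMap (Integers K) K) := by
    rw [lifts_iff_coeff_lifts]
    intro j
    rw [coeff_C_mul]
    exact ⟨⟨_, mem_integers.2 (hle j)⟩, rfl⟩
  obtain ⟨G, hG⟩ := hl
  have hG' : G.map (algebraMap (Integers K) K) = C (g.coeff i)⁻¹ * g := hG
  have hgG : g = C (g.coeff i) * G.map (algebraMap (Integers K) K) := by
    rw [hG', ← mul_assoc, ← C_mul, mul_inv_cancel₀ hi0, C_1, one_mul]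
  refine ⟨g.coeff i, G, hi0, ?_, hgG, ?_⟩
  · rw [← natDegree_map_eq_of_injective (f := algebraMap (Integers K) K) Subtype.val_injective, hG',
      natDegree_C_mul (inv_ne_zero hi0)]
  · intro h0
    have h1 : ((G.coeff i : Integers K) : K) = 1 := by
      have := congrArg (fun f => coeff f i) hG'
      simpa [hi0] using this
    have h2 : residue (Integers K) (G.coeff i) = 0 := by
      have := congrArg (fun f => coeff f i) h0
      simpa using this
    rw [residue_eq_zero_iff_norm_lt, h1, norm_one] at h2
    exact lt_irrefl _ h2

variable {L : Type*} [NormedField L] [IsUltrametricDist L] [NormedAlgebra K L]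

theorem coe_aeval_integers (t : Integers L) (G : (Integers K)[X]) :
    ((aeval t G : Integers L) : L) = aeval (t : L) (G.map (algebraMap (Integers K) K)) := by
  rw [aeval_map_algebraMap]
  exact (aeval_algebraMap_apply L t G).symm

theorem residue_aeval_integers (t : Integers L) (G : (Integers K)[X]) :
    residue (Integers L) (aeval t G) =
      aeval (residue (Integers L) t) (G.map (residue (Integers K))) := by
  rw [aeval_def, hom_eval₂, aeval_def, eval₂_map]
  rfl

end Integers

section ValueGroup

theorem mem_valueGroup {K : Type*} [NormedField K] {u : ℝˣ} :
    u ∈ valueGroup K ↔ ∃ c : K, ‖c‖ = u := by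
  constructor
  · rintro ⟨c, rfl⟩
    exact ⟨c, rfl⟩
  · rintro ⟨c, hc⟩
    have h0 : c ≠ 0 := by rw [← norm_ne_zero_iff, hc]; exact u.ne_zero
    exact ⟨Units.mk0 c h0, Units.ext hc⟩

theorem mem_of_zpow_mem_of_isCoprime {G : Type*} [Group G] (H : Subgroup G) {u : G} {m n : ℤ}
    (h : IsCoprime m n) (hm : u ^ m ∈ H) (hn : u ^ n ∈ H) : u ∈ H := by
  obtain ⟨a, b, hab⟩ := h
  have : u = (u ^ m) ^ a * (u ^ n) ^ b := by
    rw [← zpow_mul, ← zpow_mul, ← zpow_add, mul_comm m, mul_comm n, hab, zpow_one]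
  rw [this]
  exact H.mul_mem (H.zpow_mem hm a) (H.zpow_mem hn b)

theorem relIndex_sup_zpowers {G : Type*} [CommGroup G] (H : Subgroup G) {u : G} {p : ℕ}
    (hp : p.Prime) (hu : u ∉ H) (hup : u ^ p ∈ H) : H.relIndex (H ⊔ Subgroup.zpowers u) = p := by
  have : Fact p.Prime := ⟨hp⟩
  rw [Subgroup.relIndex_sup_left]
  conv_lhs => rw [← QuotientGroup.ker_mk' H]
  rw [Subgroup.relIndex_ker, MonoidHom.map_zpowers, Nat.card_zpowers]
  refine orderOf_eq_prime ?_ ?_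
  · rw [← map_pow]; exact (QuotientGroup.eq_one_iff _).2 hup
  · exact fun h => hu ((QuotientGroup.eq_one_iff _).1 h)

end ValueGroup

section Invariants

theorem valueGroup_le {K L : Type*} [NormedField K] [NormedField L] [NormedAlgebra K L] :
    valueGroup K ≤ valueGroup L := fun u hu => by
  obtain ⟨c, hc⟩ := mem_valueGroup.1 hu
  exact mem_valueGroup.2 ⟨algebraMap K L c, by rw [norm_algebraMap', hc]⟩

theorem ramificationIndex_eq_one_iff (K L : Type*) [NormedField K] [NormedField L] :
    ramificationIndex K L = 1 ↔ ∀ x : L, x ≠ 0 → ∃ c : K, ‖c‖ = ‖x‖ := by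
  rw [ramificationIndex, Subgroup.relIndex_eq_one]
  constructor
  · intro h x hx
    exact mem_valueGroup.1 (h (mem_valueGroup.2 ⟨x, rfl⟩ :
      Units.mk0 ‖x‖ (norm_ne_zero_iff.2 hx) ∈ valueGroup L))
  · intro h u hu
    obtain ⟨x, hx⟩ := mem_valueGroup.1 hu
    rw [mem_valueGroup, ← hx]
    exact h x (by rw [← norm_ne_zero_iff, hx]; exact u.ne_zero)

/-- If the norm of `w` has order `p` modulo the value group, the nonzero terms of a polynomial of
degree less than `p` in `w` have distinct norms, so one of them dominates. -/
theorem exists_norm_aeval_sub_lt_of_notMem {K L : Type*} [NormedField K] [NormedField L]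
    [IsUltrametricDist L] [NormedAlgebra K L] {p : ℕ} (hp : p.Prime) {w : L} (u : ℝˣ) (hw : ‖w‖ = u)
    (hu : u ∉ valueGroup K) (hup : u ^ p ∈ valueGroup K) (g : K[X]) (hg : g ≠ 0)
    (hdeg : g.natDegree < p) :
    ∃ i, g.coeff i ≠ 0 ∧
      ‖aeval w g - algebraMap K L (g.coeff i) * w ^ i‖ < ‖algebraMap K L (g.coeff i) * w ^ i‖ := by
  have hw0 : w ≠ 0 := by rw [← norm_ne_zero_iff, hw]; exact u.ne_zero
  obtain ⟨i, hi, hmax⟩ := (range p).exists_max_image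
    (fun i => ‖algebraMap K L (g.coeff i) * w ^ i‖) ⟨0, mem_range.2 hp.pos⟩
  have hi0 : g.coeff i ≠ 0 := by
    intro h0
    apply hg
    ext j
    by_cases hj : j < p
    · have := hmax j (mem_range.2 hj)
      rw [h0, map_zero, zero_mul, norm_zero, norm_mul, norm_algebraMap'] at this
      have h1 : 0 < ‖w ^ j‖ := norm_pos_iff.2 (pow_ne_zero j hw0)
      rw [coeff_zero, ← norm_eq_zero]
      exact le_antisymm (nonpos_of_mul_nonpos_left this h1) (norm_nonneg _)
    · rw [coeff_eq_zero_of_natDegree_lt (by omega), coeff_zero]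
  refine ⟨i, hi0, ?_⟩
  rw [aeval_eq_sum_range' hdeg, ← Finset.sum_erase_add _ _ hi, Algebra.smul_def,
    add_sub_cancel_right]
  refine norm_sum_lt _ _ (norm_pos_iff.2 (mul_ne_zero (by simpa using hi0) (pow_ne_zero i hw0)))
    fun j hj => ?_
  obtain ⟨hji, hj⟩ := Finset.mem_erase.1 hj
  rw [Algebra.smul_def]
  refine lt_of_le_of_ne (hmax j hj) fun heq => hu ?_
  rw [norm_mul, norm_mul, norm_algebraMap', norm_algebraMap', norm_pow, norm_pow, hw] at heq
  -- equality of two terms puts `u ^ (i - j)` into the value group, and `i - j` is prime to `p`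
  have hgi := norm_ne_zero_iff.2 hi0
  have hgj : g.coeff j ≠ 0 := by
    intro h0
    rw [h0, norm_zero, zero_mul] at heq
    exact mul_ne_zero hgi (pow_ne_zero i u.ne_zero) heq.symm
  have hmem : u ^ ((i : ℤ) - j) ∈ valueGroup K := by
    rw [mem_valueGroup]
    refine ⟨g.coeff j / g.coeff i, ?_⟩
    rw [norm_div, zpow_sub, zpow_natCast, zpow_natCast, Units.val_mul, Units.val_inv_eq_inv_val,
      Units.val_pow_eq_pow_val, Units.val_pow_eq_pow_val, div_eq_iff hgi, mul_right_comm,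
      eq_mul_inv_iff_mul_eq₀ (pow_ne_zero j u.ne_zero), heq, mul_comm]
  refine mem_of_zpow_mem_of_isCoprime _ (m := (i : ℤ) - j) (n := p) ?_ hmem
    (by rwa [zpow_natCast])
  rw [Int.isCoprime_iff_gcd_eq_one, Int.gcd_comm]
  have hi' := mem_range.1 hi
  have hj' := mem_range.1 hj
  rcases lt_or_gt_of_ne hji with h | h
  · rw [show (i : ℤ) - j = ((i - j : ℕ) : ℤ) by omega, Int.gcd_natCast_natCast]
    exact (hp.coprime_iff_not_dvd.2 (Nat.not_dvd_of_pos_of_lt (by omega) (by omega)))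
  · rw [show (i : ℤ) - j = -((j - i : ℕ) : ℤ) by omega, Int.gcd_neg, Int.gcd_natCast_natCast]
    exact (hp.coprime_iff_not_dvd.2 (Nat.not_dvd_of_pos_of_lt (by omega) (by omega)))

variable {K L : Type*} [NormedField K] [IsUltrametricDist K] [NormedField L] [IsUltrametricDist L]
  [NormedAlgebra K L]

theorem residueDegree_eq_one_of_forall
    (h : ∀ x : L, ‖x‖ = 1 → ∃ c : K, ‖x - algebraMap K L c‖ < 1) : residueDegree K L = 1 := by
  rw [residueDegree, finrank_eq_one_iff_of_nonzero' (1 : Residue L) one_ne_zero]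
  intro θ
  obtain ⟨x, rfl⟩ := residue_surjective θ
  by_cases hx : ‖(x : L)‖ < 1
  · exact ⟨0, by rw [zero_smul, residue_eq_zero_iff_norm_lt.2 hx]⟩
  have hx1 : ‖(x : L)‖ = 1 := le_antisymm (mem_integers.1 x.2) (not_lt.1 hx)
  obtain ⟨c, hc⟩ := h x hx1
  have hcn : ‖c‖ = 1 := by
    rw [← norm_algebraMap' L, ← hx1]
    apply norm_eq_of_norm_sub_lt
    rwa [norm_sub_rev, hx1]
  refine ⟨residue (Integers K) ⟨c, mem_integers.2 hcn.le⟩, ?_⟩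
  rw [Algebra.smul_def, mul_one]
  refine (residue_eq_residue_iff (x := algebraMap (Integers K) (Integers L) _)).2 ?_
  rw [norm_sub_rev]
  exact hc

/-- If every nonzero element of `L` is approximated by an element of `K`, with an error smaller than
itself, then `L / K` is immediate. -/
theorem isImmediate_of_forall_exists
    (h : ∀ x : L, x ≠ 0 → ∃ c : K, ‖x - algebraMap K L c‖ < ‖x‖) : IsImmediate K L := by
  refine ⟨(ramificationIndex_eq_one_iff K L).2 fun x hx => ?_,
    residueDegree_eq_one_of_forall fun x hx => ?_⟩
  · obtain ⟨c, hc⟩ := h x hx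
    refine ⟨c, ?_⟩
    rw [← norm_algebraMap' L]
    apply norm_eq_of_norm_sub_lt
    rwa [norm_sub_rev]
  · rw [← hx]
    exact h x (by rw [← norm_ne_zero_iff, hx]; exact one_ne_zero)

/-- An element `w` whose norm has order `p` modulo the value group, and in which every element of
`L` is a polynomial of degree less than `p`, determines the value group and the invariants. -/
theorem invariants_of_norm_notMem {p : ℕ} (hp : p.Prime) {w : L} (u : ℝˣ) (hw : ‖w‖ = u)
    (hu : u ∉ valueGroup K) (hup : u ^ p ∈ valueGroup K)
    (hgen : ∀ x : L, ∃ g : K[X], g.natDegree < p ∧ aeval w g = x) :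
    valueGroup L = valueGroup K ⊔ Subgroup.zpowers u ∧ ramificationIndex K L = p ∧
      residueDegree K L = 1 := by
  have hdom : ∀ x : L, x ≠ 0 → ∃ (c : K) (i : ℕ), c ≠ 0 ∧
      ‖x - algebraMap K L c * w ^ i‖ < ‖x‖ ∧ ‖x‖ = ‖c‖ * (u : ℝ) ^ i ∧ i < p := by
    intro x hx
    obtain ⟨g, hdeg, rfl⟩ := hgen x
    obtain ⟨i, hi, hlt⟩ := exists_norm_aeval_sub_lt_of_notMem hp u hw hu hup g
      (by rintro rfl; simp at hx) hdeg
    have heq := norm_eq_of_norm_sub_lt hlt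
    refine ⟨g.coeff i, i, hi, by rwa [heq], by rw [heq, norm_mul, norm_pow, norm_algebraMap', hw],
      lt_of_le_of_lt (le_natDegree_of_ne_zero hi) hdeg⟩
  have hval : valueGroup L = valueGroup K ⊔ Subgroup.zpowers u := by
    refine le_antisymm (fun v hv => ?_) (sup_le valueGroup_le ?_)
    · obtain ⟨x, hx⟩ := mem_valueGroup.1 hv
      obtain ⟨c, i, hc, -, hn, -⟩ := hdom x (by rw [← norm_ne_zero_iff, hx]; exact v.ne_zero)
      refine Subgroup.mem_sup.2 ⟨Units.mk0 ‖c‖ (norm_ne_zero_iff.2 hc), mem_valueGroup.2 ⟨c, rfl⟩,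
        u ^ i, Subgroup.npow_mem_zpowers u i, ?_⟩
      ext
      rw [← hx, hn]
      simp
    · rw [Subgroup.zpowers_le]
      exact mem_valueGroup.2 ⟨w, hw⟩
  refine ⟨hval, ?_, residueDegree_eq_one_of_forall fun x hx => ?_⟩
  · rw [ramificationIndex, hval, relIndex_sup_zpowers _ hp hu hup]
  · obtain ⟨c, i, hc, hlt, hn, hip⟩ := hdom x (by rw [← norm_ne_zero_iff, hx]; exact one_ne_zero)
    rcases Nat.eq_zero_or_pos i with rfl | hi
    · exact ⟨c, by rw [← hx]; simpa using hlt⟩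
    · exfalso
      apply hu
      refine mem_of_zpow_mem_of_isCoprime _ (m := i) (n := p) ?_ ?_ (by rwa [zpow_natCast])
      · rw [Int.isCoprime_iff_gcd_eq_one, Int.gcd_comm, Int.gcd_natCast_natCast]
        exact hp.coprime_iff_not_dvd.2 (Nat.not_dvd_of_pos_of_lt hi hip)
      · rw [zpow_natCast, mem_valueGroup]
        refine ⟨c⁻¹, ?_⟩
        rw [hx] at hn
        rw [norm_inv, Units.val_pow_eq_pow_val]
        exact inv_eq_of_mul_eq_one_right hn.symm

/-- The Gauss norm: powers of an element `t` whose residue generates an extension of degree at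
least `p` are orthonormal. -/
theorem exists_norm_aeval_eq {p : ℕ} {t : Integers L}
    (hdeg : (minpoly (Residue K) (residue (Integers L) t)).natDegree = p) (g : K[X]) (hg : g ≠ 0)
    (hgp : g.natDegree < p) :
    ∃ (c : K) (G : (Integers K)[X]), G.natDegree < p ∧
      g = C c * G.map (algebraMap (Integers K) K) ∧ ‖aeval (t : L) g‖ = ‖c‖ := by
  obtain ⟨c, G, hc, hGd, hgG, hG0⟩ := exists_eq_C_mul_map g hg
  refine ⟨c, G, by omega, hgG, ?_⟩
  have h1 : ‖((aeval t G : Integers L) : L)‖ = 1 := by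
    refine le_antisymm (mem_integers.1 (Subtype.prop _)) (not_lt.1 fun hlt => ?_)
    rw [← residue_eq_zero_iff_norm_lt, residue_aeval_integers] at hlt
    have := natDegree_le_natDegree (minpoly.degree_le_of_ne_zero (Residue K) _ hG0 hlt)
    have h2 := natDegree_map_le (f := residue (Integers K)) (p := G)
    omega
  rw [coe_aeval_integers] at h1
  rw [hgG, map_mul, aeval_C, norm_mul, h1, mul_one, norm_algebraMap']

/-- If moreover `t` generates `L` in degree less than `p`, then `L° = K°[t]`. -/
theorem exists_integral_polynomial {p : ℕ} {t : Integers L}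
    (hdeg : (minpoly (Residue K) (residue (Integers L) t)).natDegree = p)
    (hgen : ∀ x : L, ∃ g : K[X], g.natDegree < p ∧ aeval (t : L) g = x) (y : Integers L) :
    ∃ G : (Integers K)[X], G.natDegree < p ∧ aeval t G = y := by
  obtain ⟨g, hgp, hgy⟩ := hgen y
  by_cases hg : g = 0
  · refine ⟨0, by simpa [hg] using hgp, Subtype.ext ?_⟩
    rw [← hgy, hg]
    simp
  obtain ⟨c, G, hG, hgG, hn⟩ := exists_norm_aeval_eq hdeg g hg hgp
  have hc : ‖c‖ ≤ 1 := by rw [← hn, hgy]; exact mem_integers.1 y.2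
  refine ⟨C ⟨c, mem_integers.2 hc⟩ * G, (natDegree_C_mul_le _ _).trans_lt hG, Subtype.ext ?_⟩
  rw [coe_aeval_integers, Polynomial.map_mul, map_C, ← hgy, hgG]
  rfl

/-- The invariants when every element of `L` is a polynomial of degree less than `p` in an integral
element `t` whose residue has degree `p`. -/
theorem invariants_of_natDegree_minpoly_residue {p : ℕ} (hp : p.Prime) {t : Integers L}
    (hdeg : (minpoly (Residue K) (residue (Integers L) t)).natDegree = p)
    (hgen : ∀ x : L, ∃ g : K[X], g.natDegree < p ∧ aeval (t : L) g = x) :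
    IntermediateField.adjoin (Residue K) {residue (Integers L) t} = ⊤ ∧
      ramificationIndex K L = 1 ∧ residueDegree K L = p := by
  have hint : IsIntegral (Residue K) (residue (Integers L) t) := by
    by_contra h
    rw [minpoly.eq_zero h, natDegree_zero] at hdeg
    exact hp.ne_zero hdeg.symm
  have htop : IntermediateField.adjoin (Residue K) {residue (Integers L) t} = ⊤ := by
    rw [eq_top_iff]
    intro θ _
    obtain ⟨y, rfl⟩ := residue_surjective θ
    obtain ⟨G, -, rfl⟩ := exists_integral_polynomial hdeg hgen y
    rw [residue_aeval_integers]
    exact IntermediateField.algebra_adjoin_le_adjoin _ _ (aeval_mem_adjoin_singleton _ _)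
  refine ⟨htop, (ramificationIndex_eq_one_iff K L).2 fun x hx => ?_, ?_⟩
  · obtain ⟨g, hgp, rfl⟩ := hgen x
    obtain ⟨c, -, -, -, hn⟩ := exists_norm_aeval_eq hdeg g (by rintro rfl; simp at hx) hgp
    exact ⟨c, hn.symm⟩
  · rw [residueDegree, ← IntermediateField.finrank_top', ← htop,
      IntermediateField.adjoin.finrank hint, hdeg]

end Invariants

section PrimeDegree

variable {K L : Type*} [Field K] [Field L] [Algebra K L] {p : ℕ}

theorem natDegree_minpoly_of_notMem_range (hp : p.Prime) (hdeg : Module.finrank K L = p) {w : L}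
    (hw : w ∉ Set.range (algebraMap K L)) : (minpoly K w).natDegree = p := by
  have : FiniteDimensional K L := Module.finite_of_finrank_pos (hdeg ▸ hp.pos)
  have h1 := minpoly.degree_dvd (K := K) (Algebra.IsIntegral.isIntegral w)
  rw [hdeg] at h1
  refine ((Nat.dvd_prime hp).1 h1).resolve_left fun h => hw ?_
  rw [minpoly.natDegree_eq_one_iff] at h
  exact h

theorem adjoin_eq_top_of_notMem_range (hp : p.Prime) (hdeg : Module.finrank K L = p) {w : L}
    (hw : w ∉ Set.range (algebraMap K L)) : IntermediateField.adjoin K {w} = ⊤ := by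
  have : FiniteDimensional K L := Module.finite_of_finrank_pos (hdeg ▸ hp.pos)
  rw [Field.primitive_element_iff_minpoly_natDegree_eq, hdeg]
  exact natDegree_minpoly_of_notMem_range hp hdeg hw

theorem exists_aeval_eq_of_notMem_range (hp : p.Prime) (hdeg : Module.finrank K L = p) {w : L}
    (hw : w ∉ Set.range (algebraMap K L)) (x : L) :
    ∃ g : K[X], g.natDegree < p ∧ aeval w g = x := by
  have : FiniteDimensional K L := Module.finite_of_finrank_pos (hdeg ▸ hp.pos)
  have hint : IsIntegral K w := Algebra.IsIntegral.isIntegral w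
  have hx : x ∈ Algebra.adjoin K {w} := by
    have h := IntermediateField.adjoin_simple_toSubalgebra_of_isAlgebraic (F := K) hint.isAlgebraic
    rw [← h, adjoin_eq_top_of_notMem_range hp hdeg hw]
    trivial
  rw [Algebra.adjoin_singleton_eq_range_aeval] at hx
  obtain ⟨g, rfl⟩ := hx
  refine ⟨g %ₘ minpoly K w, ?_, ?_⟩
  · rw [← natDegree_minpoly_of_notMem_range hp hdeg hw]
    refine natDegree_modByMonic_lt _ (minpoly.monic hint) fun h => ?_
    have := natDegree_minpoly_of_notMem_range hp hdeg hw
    rw [h, natDegree_one] at this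
    exact hp.ne_zero this.symm
  · exact aeval_modByMonic_eq_self_of_root (minpoly.aeval K w)

end PrimeDegree

end AnalyticField

/-! ### Integrality over complete fields and étaleness -/

namespace AnalyticField

open Polynomial IsLocalRing Finset

section Integrality

instance isTorsionFree_integers (K L : Type*) [NormedField K] [IsUltrametricDist K] [NormedField L]
    [IsUltrametricDist L] [NormedAlgebra K L] :
    Module.IsTorsionFree (Integers K) (Integers L) :=
  inferInstanceAs (Module.IsTorsionFree (NormedField.valuation (K := K)).integer
    (NormedField.valuation (K := L)).integer)

theorem exists_isDistance {K L : Type*} [NormedField K] [CompleteSpace K] [NormedField L]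
    [NormedAlgebra K L] {x : L} (hx : x ∉ Set.range (algebraMap K L)) : ∃ r, IsDistance K x r := by
  have hcl : IsClosed (Set.range (algebraMap K L)) :=
    (algebraMap_isometry K L).isClosedEmbedding.isClosed_range
  refine ⟨Metric.infDist x (Set.range (algebraMap K L)),
    (hcl.notMem_iff_infDist_pos (Set.range_nonempty _)).1 hx, fun c => ?_, fun ρ hρ => ?_⟩
  · rw [← dist_eq_norm]
    exact Metric.infDist_le_dist_of_mem ⟨c, rfl⟩
  · obtain ⟨_, ⟨c, rfl⟩, hc⟩ := (Metric.infDist_lt_iff (Set.range_nonempty _)).1 hρ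
    exact ⟨c, by rwa [← dist_eq_norm]⟩

variable {K : Type*} [NontriviallyNormedField K] [IsUltrametricDist K] [CompleteSpace K]
  {L : Type*} [NormedField L] [NormedAlgebra K L]

theorem norm_coeff_minpoly_le [Algebra.IsAlgebraic K L] (x : L) {i : ℕ}
    (hi : i < (minpoly K x).natDegree) :
    ‖(minpoly K x).coeff i‖ ≤ ‖x‖ ^ ((minpoly K x).natDegree - i) := by
  have h1 : spectralValueTerms (minpoly K x) i ≤ ‖x‖ := by
    rw [NormedAlgebra.norm_eq_spectralNorm K x]
    exact le_ciSup (spectralValueTerms_bddAbove (minpoly K x)) i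
  rw [spectralValueTerms_of_lt_natDegree _ hi] at h1
  have h2 : ((minpoly K x).natDegree : ℝ) - i = (((minpoly K x).natDegree - i : ℕ) : ℝ) := by
    rw [Nat.cast_sub hi.le]
  rw [h2] at h1
  have h3 := pow_le_pow_left₀ (by positivity) h1 ((minpoly K x).natDegree - i)
  rwa [one_div, Real.rpow_inv_natCast_pow (norm_nonneg _) (by omega)] at h3

theorem norm_coeff_zero_minpoly [Algebra.IsAlgebraic K L] (x : L) :
    ‖(minpoly K x).coeff 0‖ = ‖x‖ ^ (minpoly K x).natDegree := by
  have hpos := minpoly.natDegree_pos (Algebra.IsIntegral.isIntegral (R := K) x)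
  rw [NormedAlgebra.norm_eq_spectralNorm K x, spectralNorm.spectralNorm_eq_norm_coeff_zero_rpow,
    one_div, Real.rpow_inv_natCast_pow (norm_nonneg _) hpos.ne']

variable [IsUltrametricDist L]

variable (K L) in
theorem isIntegral_integers [Algebra.IsAlgebraic K L] :
    Algebra.IsIntegral (Integers K) (Integers L) := by
  refine ⟨fun y => ?_⟩
  have hmon := minpoly.monic (Algebra.IsIntegral.isIntegral (R := K) (y : L))
  have hcoeff : ∀ i, ‖(minpoly K (y : L)).coeff i‖ ≤ 1 := by
    intro i
    rcases lt_trichotomy i (minpoly K (y : L)).natDegree with h | h | h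
    · exact (norm_coeff_minpoly_le _ h).trans (pow_le_one₀ (norm_nonneg _) (mem_integers.1 y.2))
    · rw [h, coeff_natDegree, hmon.leadingCoeff, norm_one]
    · rw [coeff_eq_zero_of_natDegree_lt h, norm_zero]; exact zero_le_one
  have hl : minpoly K (y : L) ∈ lifts (algebraMap (Integers K) K) := by
    rw [lifts_iff_coeff_lifts]
    exact fun i => ⟨⟨_, mem_integers.2 (hcoeff i)⟩, rfl⟩
  obtain ⟨Q, hQ, -, hQm⟩ := lifts_and_natDegree_eq_and_monic hl hmon
  refine ⟨Q, hQm, Subtype.ext ?_⟩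
  rw [← aeval_def, coe_aeval_integers, hQ, minpoly.aeval]
  rfl

theorem map_minpoly_integers [Algebra.IsAlgebraic K L] (t : Integers L) :
    (minpoly (Integers K) t).map (algebraMap (Integers K) K) = minpoly K (t : L) :=
  have := isIntegral_integers K L
  (minpoly.isIntegrallyClosed_eq_field_fractions K L
    (Algebra.IsIntegral.isIntegral (R := Integers K) t)).symm

theorem natDegree_minpoly_integers [Algebra.IsAlgebraic K L] (t : Integers L) :
    (minpoly (Integers K) t).natDegree = (minpoly K (t : L)).natDegree := by
  rw [← map_minpoly_integers t, natDegree_map_eq_of_injective Subtype.val_injective]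

/-- The inverse in `L°` of a unit of `K°[t]` lies in `K°[t]`, because `L°` is integral over it. -/
theorem exists_aeval_mul_eq_one [Algebra.IsAlgebraic K L] (t : Integers L) (H : (Integers K)[X])
    (hH : IsUnit (aeval t H)) : ∃ G : (Integers K)[X], aeval t H * aeval t G = 1 := by
  have := isIntegral_integers K L
  let S := Algebra.adjoin (Integers K) {t}
  have hint : (algebraMap S (Integers L)).IsIntegral := fun y =>
    (Algebra.IsIntegral.isIntegral (R := Integers K) y).tower_top
  have hloc : IsLocalHom (algebraMap S (Integers L)) :=
    hint.isLocalHom Subtype.val_injective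
  let h : S := ⟨aeval t H, aeval_mem_adjoin_singleton _ _⟩
  obtain ⟨g, hg⟩ := (isUnit_of_map_unit (algebraMap S (Integers L)) h hH).exists_right_inv
  obtain ⟨G, hG⟩ : ∃ G : (Integers K)[X], aeval t G = (g : Integers L) := by
    have hmem : (g : Integers L) ∈ Algebra.adjoin (Integers K) {t} := g.2
    rwa [Algebra.adjoin_singleton_eq_range_aeval] at hmem
  exact ⟨G, by rw [hG]; exact congrArg Subtype.val hg⟩

/-- In prime degree, an integral element whose residue is not in the residue field of `K` has a
residue of degree `p`: the reduction of its minimal polynomial is a power of the minimal polynomial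
of the residue, since `K°[t]` is local. -/
theorem natDegree_minpoly_residue {p : ℕ} (hp : p.Prime) (hdeg : Module.finrank K L = p)
    {t : Integers L}
    (ht : residue (Integers L) t ∉ Set.range (algebraMap (Residue K) (Residue L))) :
    (minpoly (Residue K) (residue (Integers L) t)).natDegree = p := by
  have : FiniteDimensional K L := Module.finite_of_finrank_pos (hdeg ▸ hp.pos)
  have := isIntegral_integers K L
  have htint : IsIntegral (Integers K) t := Algebra.IsIntegral.isIntegral t
  set θ := residue (Integers L) t with hθ
  set Q := minpoly (Integers K) t with hQ
  set m := minpoly (Residue K) θ with hm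
  have hQm : Q.Monic := minpoly.monic htint
  have htK : (t : L) ∉ Set.range (algebraMap K L) := by
    rintro ⟨c, hc⟩
    have hcn : ‖c‖ ≤ 1 := by rw [← norm_algebraMap' L, hc]; exact mem_integers.1 t.2
    refine ht ⟨residue (Integers K) ⟨c, mem_integers.2 hcn⟩, ?_⟩
    rw [hθ]
    exact congrArg (residue (Integers L)) (Subtype.ext hc)
  have hQd : Q.natDegree = p := by
    rw [hQ, natDegree_minpoly_integers, natDegree_minpoly_of_notMem_range hp hdeg htK]
  set q := Q.map (residue (Integers K)) with hq
  have hqm : q.Monic := hQm.map _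
  have hqd : q.natDegree = p := by rw [hq, hQm.natDegree_map, hQd]
  have hqθ : aeval θ q = 0 := by
    rw [hq, hθ, ← residue_aeval_integers, hQ, minpoly.aeval, map_zero]
  have hθint : IsIntegral (Residue K) θ := ⟨q, hqm, hqθ⟩
  have hm1 : m.natDegree ≠ 1 := fun h => ht (minpoly.natDegree_eq_one_iff.1 h)
  have hmpos : 0 < m.degree := minpoly.degree_pos hθint
  obtain ⟨h, hqh, hmh⟩ := (finiteMultiplicity_of_degree_pos_of_monic hmpos (minpoly.monic hθint)
    hqm.ne_zero).exists_eq_pow_mul_and_not_dvd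
  have hhunit : IsUnit h := by
    obtain ⟨H, hH⟩ := Polynomial.map_surjective _ (residue_surjective (R := Integers K)) h
    have hHt : IsUnit (aeval t H) := by
      rw [isUnit_integers_iff]
      refine le_antisymm (mem_integers.1 (Subtype.prop _)) (not_lt.1 fun hlt => hmh ?_)
      rw [← residue_eq_zero_iff_norm_lt, residue_aeval_integers, hH] at hlt
      exact minpoly.dvd _ _ hlt
    obtain ⟨G, hG⟩ := exists_aeval_mul_eq_one t H hHt
    have hdvd : Q ∣ H * G - 1 := minpoly.isIntegrallyClosed_dvd htint (by
      rw [map_sub, map_mul, hG, map_one, sub_self])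
    have hdvd' : h ∣ h * G.map (residue (Integers K)) - 1 := by
      have h1 := Polynomial.map_dvd (residue (Integers K)) hdvd
      rw [Polynomial.map_sub, Polynomial.map_mul, hH, Polynomial.map_one] at h1
      exact (Dvd.intro_left _ hqh.symm).trans h1
    exact isUnit_of_dvd_one ((dvd_sub_right (dvd_mul_right _ _)).1 hdvd')
  have hdegs : p = multiplicity m q * m.natDegree := by
    rw [← hqd]
    conv_lhs => rw [hqh]
    rw [natDegree_mul (pow_ne_zero _ (minpoly.ne_zero hθint)) hhunit.ne_zero, natDegree_pow,
      natDegree_eq_zero_of_isUnit hhunit, add_zero]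
  exact ((Nat.dvd_prime hp).1 (Dvd.intro_left _ hdegs.symm)).resolve_left hm1

/-- An extension of prime degree `p` generated by an integral element whose residue is separable of
degree `p` is unramified: `L°` is the standard étale algebra `K°[t]`. -/
theorem etale_of_separable {p : ℕ} (hp : p.Prime) (hdeg : Module.finrank K L = p) {t : Integers L}
    (ht : (minpoly (Residue K) (residue (Integers L) t)).natDegree = p)
    (hsep : (minpoly (Residue K) (residue (Integers L) t)).Separable)
    (htK : (t : L) ∉ Set.range (algebraMap K L)) :
    Algebra.Etale (Integers K) (Integers L) := by
  have : FiniteDimensional K L := Module.finite_of_finrank_pos (hdeg ▸ hp.pos)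
  have := isIntegral_integers K L
  have htint : IsIntegral (Integers K) t := Algebra.IsIntegral.isIntegral t
  have hgen := exists_integral_polynomial ht (exists_aeval_eq_of_notMem_range hp hdeg htK)
  set θ := residue (Integers L) t with hθ
  set Q := minpoly (Integers K) t with hQ
  have hQm : Q.Monic := minpoly.monic htint
  have hQd : Q.natDegree = p := by
    rw [hQ, natDegree_minpoly_integers, natDegree_minpoly_of_notMem_range hp hdeg htK]
  have hqθ : aeval θ (Q.map (residue (Integers K))) = 0 := by
    rw [hθ, ← residue_aeval_integers, hQ, minpoly.aeval, map_zero]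
  have hred : Q.map (residue (Integers K)) = minpoly (Residue K) θ :=
    eq_of_monic_of_dvd_of_natDegree_le (minpoly.monic ⟨_, hQm.map _, hqθ⟩) (hQm.map _)
      (minpoly.dvd _ _ hqθ) (by rw [hQm.natDegree_map, hQd, ht])
  have hunit : IsUnit (aeval t (derivative Q)) := by
    rw [isUnit_integers_iff]
    refine le_antisymm (mem_integers.1 (Subtype.prop _)) (not_lt.1 fun hlt => ?_)
    rw [← residue_eq_zero_iff_norm_lt, residue_aeval_integers, ← derivative_map, hred] at hlt
    exact hsep.aeval_derivative_ne_zero (minpoly.aeval _ _) hlt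
  obtain ⟨y, hy⟩ := hunit.exists_right_inv
  obtain ⟨G, -, rfl⟩ := hgen y
  obtain ⟨R, hR⟩ : Q ∣ derivative Q * G - 1 := minpoly.isIntegrallyClosed_dvd htint (by
    rw [map_sub, map_mul, hy, map_one, sub_self])
  let P : StandardEtalePair (Integers K) := ⟨Q, hQm, 1, G, -R, 1, by
    rw [one_pow]; linear_combination hR⟩
  have hmap : P.HasMap t := ⟨minpoly.aeval _ _, by simp [P]⟩
  have hsurj : ∀ x : P.Ring, ∃ F : (Integers K)[X], x = aeval P.X F := by
    intro x
    let S : StandardEtalePresentation (Integers K) P.Ring :=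
      ⟨P, P.X, P.hasMap_X, by simpa [StandardEtalePair.lift_X_left] using Function.bijective_id⟩
    obtain ⟨F, n, hF⟩ := S.exists_mul_aeval_x_g_pow_eq_aeval_x x
    exact ⟨F, by simpa [S, P] using hF⟩
  have hlift : ∀ F : (Integers K)[X], P.lift t hmap (aeval P.X F) = aeval t F := by
    intro F
    rw [← aeval_algHom_apply, StandardEtalePair.lift_X]
  have hbij : Function.Bijective (P.lift t hmap) := by
    refine ⟨(injective_iff_map_eq_zero _).2 fun x hx => ?_, fun y => ?_⟩
    · obtain ⟨F, rfl⟩ := hsurj x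
      rw [hlift] at hx
      obtain ⟨F', rfl⟩ := minpoly.isIntegrallyClosed_dvd htint hx
      rw [map_mul]
      have : aeval P.X Q = 0 := P.hasMap_X.1
      rw [this, zero_mul]
    · obtain ⟨F, -, rfl⟩ := hgen y
      exact ⟨_, hlift F⟩
  exact Algebra.Etale.of_equiv (AlgEquiv.ofBijective _ hbij)

theorem isModeratelyRamified_of_etale {K L : Type*} [NormedField K] [IsUltrametricDist K]
    [NormedField L] [IsUltrametricDist L] [NormedAlgebra K L] {p : ℕ} [FiniteDimensional K L]
    (h : Algebra.Etale (Integers K) (Integers L)) : IsModeratelyRamified K L p := by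
  refine ⟨inferInstance, ⊤, ⟨inferInstance, ?_⟩, ?_⟩
  · have hmem : ∀ x : L, x ∈ Integers L ↔
        (⟨x, trivial⟩ : (⊤ : IntermediateField K L)) ∈ Integers (⊤ : IntermediateField K L) :=
      fun x => by rw [mem_integers, mem_integers]; rfl
    let e : Integers L ≃ₐ[Integers K] Integers (⊤ : IntermediateField K L) :=
      { toFun := fun x => ⟨⟨x, trivial⟩, (hmem _).1 x.2⟩
        invFun := fun x => ⟨x.1.1, (hmem _).2 x.2⟩
        left_inv := fun _ => rfl
        right_inv := fun _ => rfl
        map_mul' := fun _ _ => rfl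
        map_add' := fun _ _ => rfl
        commutes' := fun _ => rfl }
    exact Algebra.Etale.of_equiv e
  · rw [IntermediateField.finrank_top]
    exact Nat.coprime_one_left p

end Integrality

end AnalyticField

/-! ### Existence of approximate roots in wildly ramified extensions -/

namespace AnalyticField

open Polynomial IsLocalRing Finset

section Attained

theorem norm_div_sub_lt_one_iff {K L : Type*} [NormedField K] [NormedField L] [NormedAlgebra K L]
    {x y : L} {c : K} (hc : c ≠ 0) :
    ‖x / algebraMap K L c - y‖ < 1 ↔ ‖x - y * algebraMap K L c‖ < ‖c‖ := by
  have hc' : algebraMap K L c ≠ 0 := by simpa using hc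
  rw [div_sub' hc', norm_div, norm_algebraMap', div_lt_one (norm_pos_iff.2 hc), mul_comm y]

variable {K : Type*} [NormedField K] [IsUltrametricDist K]
  {L : Type*} [NormedField L] [IsUltrametricDist L] [NormedAlgebra K L] {p : ℕ}

/-- An element at distance `r` from `K`, divided by an element of `K` of norm `r`, has a residue
outside the residue field of `K` whenever the quotient is integral. -/
theorem IsDistance.residue_notMem_range {x : L} {r : ℝ} (hx : IsDistance K x r) {c : K}
    (hc : ‖c‖ = r) (t : Integers L) (ht : (t : L) = x / algebraMap K L c) :
    residue (Integers L) t ∉ Set.range (algebraMap (Residue K) (Residue L)) := by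
  rintro ⟨θ, hθ⟩
  obtain ⟨d, rfl⟩ := residue_surjective θ
  have h1 : ‖(t : L) - algebraMap K L d‖ < 1 :=
    residue_eq_residue_iff (y := algebraMap (Integers K) (Integers L) d).1 hθ.symm
  have hc0 : c ≠ 0 := by rw [← norm_ne_zero_iff, hc]; exact hx.pos.ne'
  rw [ht, norm_div_sub_lt_one_iff hc0, ← map_mul, hc] at h1
  exact (hx.le _).not_gt h1

theorem natDegree_minpoly_of_pow_eq {k l : Type*} [Field k] [Field l] [Algebra k l] (hp : p.Prime)
    [CharP k p] {θ : l} {β : k} (hθ : θ ^ p = algebraMap k l β)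
    (hnot : θ ∉ Set.range (algebraMap k l)) : (minpoly k θ).natDegree = p := by
  have : Fact p.Prime := ⟨hp⟩
  have : CharP l p := charP_of_injective_algebraMap (algebraMap k l).injective p
  have hirr : Irreducible (X ^ p - C β) := X_pow_sub_C_irreducible_of_prime hp fun b hb => hnot
    ⟨b, frobenius_inj l p (by simp only [frobenius_def]; rw [hθ, ← hb, map_pow])⟩
  rw [← minpoly.eq_of_irreducible_of_monic hirr (by simp [hθ]) (monic_X_pow_sub_C _ hp.ne_zero),
    natDegree_X_pow_sub_C]

/-- If `y` is given by `c₁` and has the norm `r ^ p`, then `(c₁ - z) / c` has norm one, and the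
`p`-th power of its residue is the residue of `y / c ^ p`. -/
theorem IsApproximateRoot.exists_residue [CharP (Residue K) p] (hp : p.Prime) {b : K} {z : L}
    {r : ℝ} (h : IsApproximateRoot p b 0 z r) {y : K} (hy : y ∈ coset p b 0 (r ^ p))
    (hyn : ‖y‖ = r ^ p) {c : K} (hc : ‖c‖ = r) :
    ∃ v : Integers K, (v : K) = y / c ^ p ∧ ∃ t : Integers L,
      residue (Integers L) t ^ p =
        algebraMap (Residue K) (Residue L) (residue (Integers K) v) ∧
      (minpoly (Residue K) (residue (Integers L) t)).natDegree = p ∧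
      (t : L) ∉ Set.range (algebraMap K L) := by
  have hr := h.isDistance.pos
  have hc0 : c ≠ 0 := by rw [← norm_ne_zero_iff, hc]; exact hr.ne'
  obtain ⟨_, ⟨c₁, d, hc₁, hd, rfl⟩, rfl⟩ := hy
  dsimp only at hyn ⊢
  have hw : ‖z - algebraMap K L c₁‖ = r := by
    rw [h.norm_coset hp hc₁ hd] at hyn
    exact (pow_left_inj₀ (norm_nonneg _) hr.le hp.ne_zero).1 hyn
  have hw' : ‖algebraMap K L c₁ - z‖ = r := by rw [norm_sub_rev, hw]
  have hdist : IsDistance K (algebraMap K L c₁ - z) r := by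
    have h1 := h.isDistance.sub_algebraMap c₁
    refine ⟨hr, fun e => ?_, fun ρ hρ => ?_⟩
    · have := h1.le (-e)
      rwa [← norm_neg, show -(z - algebraMap K L c₁ - algebraMap K L (-e)) =
        algebraMap K L c₁ - z - algebraMap K L e by rw [map_neg]; ring] at this
    · obtain ⟨e, he⟩ := h1.exists_lt ρ hρ
      refine ⟨-e, ?_⟩
      rwa [← norm_neg, show -(z - algebraMap K L c₁ - algebraMap K L e) =
        algebraMap K L c₁ - z - algebraMap K L (-e) by rw [map_neg]; ring] at he
  let v : Integers K := ⟨(b + (c₁ ^ p - 0 * c₁ + d)) / c ^ p, mem_integers.2 (by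
    rw [norm_div, norm_pow, hc, hyn, div_self (pow_pos hr p).ne'])⟩
  let t : Integers L := ⟨(algebraMap K L c₁ - z) / algebraMap K L c, mem_integers.2 (by
    rw [norm_div, norm_algebraMap', hc, hw', div_self hr.ne'])⟩
  have hpow : residue (Integers L) t ^ p =
      algebraMap (Residue K) (Residue L) (residue (Integers K) v) := by
    rw [← map_pow]
    refine (residue_eq_residue_iff (y := algebraMap (Integers K) (Integers L) v)).2 ?_
    change ‖((algebraMap K L c₁ - z) / algebraMap K L c) ^ p -
      algebraMap K L ((b + (c₁ ^ p - 0 * c₁ + d)) / c ^ p)‖ < 1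
    have h1 := norm_coset_sub_lt hp h.norm_mul_pow_lt h.norm_lt hc₁ hd
    rw [map_div₀, map_pow, div_pow, ← sub_div, norm_div, norm_pow, norm_algebraMap', hc,
      div_lt_one (pow_pos hr p), norm_sub_rev]
    simpa using h1
  refine ⟨v, rfl, t, hpow, natDegree_minpoly_of_pow_eq hp hpow
    (hdist.residue_notMem_range hc t rfl), ?_⟩
  rintro ⟨e, he⟩
  refine hdist.notMem_range ⟨e * c, ?_⟩
  rw [map_mul, he]
  exact div_mul_cancel₀ _ (by simpa using hc0)

theorem isPurelyInseparable_of_pow_eq {k l : Type*} [Field k] [Field l] [Algebra k l] (hp : p.Prime)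
    [CharP k p] {θ : l} {β : k} (hθ : θ ^ p = algebraMap k l β)
    (htop : IntermediateField.adjoin k {θ} = ⊤) : IsPurelyInseparable k l := by
  have : Fact p.Prime := ⟨hp⟩
  rw [isPurelyInseparable_iff_perfectClosure_eq_top, eq_top_iff, ← htop,
    IntermediateField.adjoin_simple_le_iff, mem_perfectClosure_iff]
  exact ⟨1, β, by rw [pow_one, ringExpChar.eq k p, hθ]⟩

/-- The `p`-th power of an inseparable element of degree `p` lies in the base field: its minimal
polynomial is a polynomial in `T ^ p`, hence of the form `T ^ p - β`. -/
theorem exists_pow_eq_of_not_separable {k l : Type*} [Field k] [Field l] [Algebra k l]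
    (hp : p.Prime) [CharP k p] {θ : l} (hdeg : (minpoly k θ).natDegree = p)
    (hsep : ¬ (minpoly k θ).Separable) : ∃ β : k, θ ^ p = algebraMap k l β := by
  have hint : IsIntegral k θ := by
    by_contra h
    rw [minpoly.eq_zero h, natDegree_zero] at hdeg
    exact hp.ne_zero hdeg.symm
  obtain ⟨-, g, -, hg⟩ := (separable_or p (minpoly.irreducible hint)).resolve_left hsep
  have hg1 : g.natDegree = 1 := by
    rw [← hg, natDegree_expand] at hdeg
    exact Nat.eq_of_mul_eq_mul_right hp.pos (by rw [hdeg, one_mul])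
  have hgm : g.Monic := by
    have := minpoly.monic hint
    rwa [← hg, monic_expand_iff hp.pos] at this
  have h0 := minpoly.aeval k θ
  rw [← hg, hgm.eq_X_add_C hg1, map_add, expand_X, expand_C, map_add, map_pow, aeval_X,
    aeval_C] at h0
  exact ⟨-g.coeff 0, by rw [map_neg]; exact eq_neg_of_add_eq_zero_left h0⟩

end Attained

section Existence

variable {K : Type*} [NontriviallyNormedField K] [IsUltrametricDist K] [CompleteSpace K]
  {L : Type*} [NormedField L] [IsUltrametricDist L] [NormedAlgebra K L] {p : ℕ}

/-- In a wildly ramified extension of degree `p`, an element whose norm is its distance to `K` gives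
rise to an approximate `p`-th root. If the middle coefficients of its minimal polynomial are
negligible, the element itself qualifies. Otherwise its norm lies in the value group, and its
residue after rescaling generates an extension of degree `p`, which is inseparable by wildness. -/
theorem IsDistance.exists_isApproximateRoot [CharP (Residue K) p] (hp : p.Prime)
    (hdeg : Module.finrank K L = p) (hwild : IsWildlyRamified K L p) {x : L} {r : ℝ}
    (hx : IsDistance K x r) (hxr : ‖x‖ = r) :
    ∃ (b : K), IsApproximateRoot p b 0 x r := by
  have : FiniteDimensional K L := hwild.1
  have hr := hx.pos
  have hrp := pow_pos hr p
  have hpL : ‖(p : L)‖ < 1 := by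
    rw [← map_natCast (algebraMap K L), norm_algebraMap']; exact norm_natCast_lt_one p
  have hpx : ‖(p : L) * x ^ p‖ < r ^ p := by
    rw [norm_mul, norm_pow, hxr]; exact mul_lt_of_lt_one_left hrp hpL
  have hPd := natDegree_minpoly_of_notMem_range hp hdeg hx.notMem_range
  set P := minpoly K x with hP
  have hPm : P.Monic := minpoly.monic (Algebra.IsIntegral.isIntegral x)
  by_cases hall : ∀ i, 0 < i → i < p → ‖P.coeff i‖ < r ^ (p - i)
  · refine ⟨P.coeff 0, hx, hpx, ?_, Or.inl rfl⟩
    have hsum : aeval x P = 0 := minpoly.aeval K x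
    rw [aeval_eq_sum_range, hPd, Finset.sum_range_succ, Finset.range_eq_Ico,
      Finset.sum_eq_sum_Ico_succ_bot hp.pos, pow_zero, Algebra.smul_def, mul_one] at hsum
    have hlead : P.coeff p = 1 := by rw [← hPd]; exact hPm.coeff_natDegree
    rw [hlead, one_smul] at hsum
    have heq : x ^ p - algebraMap K L 0 * x + algebraMap K L (P.coeff 0) =
        -∑ i ∈ Ico (0 + 1) p, P.coeff i • x ^ i := by
      rw [map_zero]; linear_combination hsum
    rw [heq, norm_neg]
    refine norm_sum_lt _ _ hrp fun i hi => ?_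
    obtain ⟨h1, h2⟩ := Finset.mem_Ico.1 hi
    rw [norm_smul, norm_pow, hxr]
    calc ‖P.coeff i‖ * r ^ i < r ^ (p - i) * r ^ i :=
          mul_lt_mul_of_pos_right (hall i (by omega) h2) (pow_pos hr i)
      _ = r ^ p := by rw [← pow_add]; congr 1; omega
  · push Not at hall
    obtain ⟨i, hi0, hip, hi⟩ := hall
    have hin : ‖P.coeff i‖ = r ^ (p - i) := by
      refine le_antisymm ?_ hi
      have := norm_coeff_minpoly_le (K := K) x (i := i) (by rw [← hP, hPd]; exact hip)
      rwa [← hP, hPd, hxr] at this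
    have h0n : ‖P.coeff 0‖ = r ^ p := by
      have := norm_coeff_zero_minpoly (K := K) x
      rwa [← hP, hPd, hxr] at this
    obtain ⟨c, hc⟩ : ∃ c : K, ‖c‖ = r := by
      have : Units.mk0 r hr.ne' ∈ valueGroup K := by
        refine mem_of_zpow_mem_of_isCoprime _ (m := ((p - i : ℕ) : ℤ)) (n := p) ?_ ?_ ?_
        · rw [Int.isCoprime_iff_gcd_eq_one, Int.gcd_comm, Int.gcd_natCast_natCast]
          exact hp.coprime_iff_not_dvd.2 (Nat.not_dvd_of_pos_of_lt (by omega) (by omega))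
        · rw [zpow_natCast, mem_valueGroup]
          exact ⟨_, hin⟩
        · rw [zpow_natCast, mem_valueGroup]
          exact ⟨_, h0n⟩
      exact mem_valueGroup.1 this
    have hc0 : c ≠ 0 := by rw [← norm_ne_zero_iff, hc]; exact hr.ne'
    let t : Integers L := ⟨x / algebraMap K L c, mem_integers.2 (by
      rw [norm_div, norm_algebraMap', hc, hxr, div_self hr.ne'])⟩
    have hres := hx.residue_notMem_range hc t rfl
    have hresd := natDegree_minpoly_residue hp hdeg hres
    have hsep : ¬ (minpoly (Residue K) (residue (Integers L) t)).Separable := by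
      intro hsep
      refine hwild.2 (isModeratelyRamified_of_etale (etale_of_separable hp hdeg hresd hsep ?_))
      rintro ⟨e, he⟩
      exact hx.notMem_range ⟨e * c, by
        rw [map_mul, he]; exact div_mul_cancel₀ _ (by simpa using hc0)⟩
    obtain ⟨β, hβ⟩ := exists_pow_eq_of_not_separable hp hresd hsep
    obtain ⟨d, rfl⟩ := residue_surjective β
    rw [← map_pow] at hβ
    have h1 : ‖(x / algebraMap K L c) ^ p - algebraMap K L d‖ < 1 :=
      (residue_eq_residue_iff (y := algebraMap (Integers K) (Integers L) d)).1 hβ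
    rw [div_pow, ← map_pow, norm_div_sub_lt_one_iff (pow_ne_zero p hc0), norm_pow, hc,
      ← map_mul] at h1
    refine ⟨-((d : K) * c ^ p), hx, hpx, ?_, Or.inl rfl⟩
    simpa [sub_eq_add_neg] using h1

/-- Any element outside `K` yields an approximate root, by one of two constructions according to
whether its distance to `K` is attained. -/
theorem IsWildlyRamified.exists_isApproximateRoot [CharP (Residue K) p] (hp : p.Prime)
    (hdeg : Module.finrank K L = p) (hwild : IsWildlyRamified K L p) :
    ∃ (b a : K) (z : L) (r : ℝ), IsApproximateRoot p b a z r := by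
  have : FiniteDimensional K L := hwild.1
  have hpL : ‖(p : L)‖ < 1 := by
    rw [← map_natCast (algebraMap K L), norm_algebraMap']; exact norm_natCast_lt_one p
  obtain ⟨x, hx⟩ : ∃ x : L, x ∉ Set.range (algebraMap K L) := by
    by_contra! h
    have : Module.finrank K L = 1 := by
      rw [finrank_eq_one_iff_of_nonzero' (1 : L) one_ne_zero]
      intro w
      obtain ⟨c, rfl⟩ := h w
      exact ⟨c, by rw [Algebra.smul_def, mul_one]⟩
    rw [hdeg] at this
    exact hp.one_lt.ne' this
  obtain ⟨r, hr⟩ := exists_isDistance hx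
  by_cases hatt : ∃ c : K, ‖x - algebraMap K L c‖ = r
  · obtain ⟨c, hc⟩ := hatt
    obtain ⟨b, hb⟩ := (hr.sub_algebraMap c).exists_isApproximateRoot hp hdeg hwild hc
    exact ⟨b, 0, _, r, hb⟩
  · push Not at hatt
    have hun : IsUnattainedDistance K x r := ⟨hr, fun c => (hr.le c).lt_of_ne (hatt c).symm⟩
    obtain ⟨b, a, z, h, -⟩ := hun.exists_isApproximateRoot hp hpL (minpoly K x)
      (minpoly.monic (Algebra.IsIntegral.isIntegral x))
      (natDegree_minpoly_of_notMem_range hp hdeg hx) (minpoly.aeval K x)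
    exact ⟨b, a, z, r, h⟩

end Existence

end AnalyticField

/-! ### Roots, invariants and base change -/

namespace AnalyticField

open Polynomial IsLocalRing Finset

section Root

variable {K : Type*} [NormedField K] {L : Type*} [NormedField L] [IsUltrametricDist L]
  [NormedAlgebra K L] {p : ℕ}

/-- If `‖a‖ = r ^ (p - 1)`, an approximate root can be refined to a root, which is again outside
`K`: near `z` the map `y ↦ (y ^ p + b) / a` is a contraction. -/
theorem IsApproximateRoot.exists_root [CompleteSpace L] (hp : p.Prime) {b a : K} {z : L} {r : ℝ}
    (h : IsApproximateRoot p b a z r) (ha : ‖a‖ = r ^ (p - 1))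
    (hun : ∀ c : K, r < ‖z - algebraMap K L c‖) :
    ∃ α : L, α ^ p - algebraMap K L a * α + algebraMap K L b = 0 ∧
      α ∉ Set.range (algebraMap K L) := by
  have hr := h.isDistance.pos
  have hpp : p - 1 ≠ 0 := by have := hp.two_le; omega
  have hsplit : r ^ p = r ^ (p - 1) * r := by
    rw [← pow_succ, Nat.sub_one_add_one hp.ne_zero]
  have ha0 : 0 < ‖a‖ := by rw [ha]; positivity
  set A := algebraMap K L a with hA
  set B := algebraMap K L b with hB
  have hAn : ‖A‖ = ‖a‖ := norm_algebraMap' L a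
  have hA0 : A ≠ 0 := by rw [← norm_pos_iff, hAn]; exact ha0
  have hrz : r < ‖z‖ := by simpa using hun 0
  set ρ := ‖z ^ p - A * z + B‖ / ‖a‖ with hρ
  have hρ0 : 0 ≤ ρ := by positivity
  have hρr : ρ < r := by
    rw [hρ, div_lt_iff₀ ha0, ha, mul_comm r, ← hsplit]; exact h.norm_lt
  set κ := max (ρ ^ (p - 1)) (‖(p : L)‖ * ‖z‖ ^ (p - 1)) / ‖a‖ with hκ
  have hκ0 : 0 ≤ κ := by positivity
  have hκ1 : κ < 1 := by
    rw [hκ, div_lt_one ha0, max_lt_iff, ha]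
    refine ⟨pow_lt_pow_left₀ hρr hρ0 hpp, ?_⟩
    have h1 := h.norm_mul_pow_lt
    rw [norm_mul, norm_pow, hsplit, ← pow_sub_one_mul hp.ne_zero ‖z‖, ← mul_assoc] at h1
    by_contra! hle
    have : r ^ (p - 1) * r ≤ ‖(p : L)‖ * ‖z‖ ^ (p - 1) * ‖z‖ := by gcongr
    exact this.not_gt h1
  let φ : L → L := fun y => (y ^ p + B) / A
  have hball : ∀ y ∈ Metric.closedBall z ρ, ‖y‖ ≤ ‖z‖ := by
    intro y hy
    rw [mem_closedBall_iff_norm] at hy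
    rw [← sub_add_cancel y z]
    exact (IsUltrametricDist.norm_add_le_max _ _).trans
      (max_le (hy.trans (hρr.le.trans hrz.le)) le_rfl)
  have hlip : ∀ y ∈ Metric.closedBall z ρ, ∀ y' ∈ Metric.closedBall z ρ,
      ‖φ y - φ y'‖ ≤ κ * ‖y - y'‖ := by
    intro y hy y' hy'
    have hu : ‖y - y'‖ ≤ ρ := by
      rw [mem_closedBall_iff_norm] at hy
      rw [mem_closedBall_iff_norm'] at hy'
      rw [← sub_add_sub_cancel y z y']
      exact (IsUltrametricDist.norm_add_le_max _ _).trans (max_le hy hy')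
    have h1 := norm_add_pow_sub_le hp (hu.trans (hρr.le.trans hrz.le)) (hball y' hy')
    rw [sub_add_cancel] at h1
    have h2 : φ y - φ y' = ((y ^ p - (y - y') ^ p - y' ^ p) + (y - y') ^ p) / A := by
      simp only [φ]; rw [← sub_div]; congr 1; ring
    rw [h2, norm_div, hAn, hκ, div_mul_eq_mul_div]
    refine div_le_div_of_nonneg_right ((IsUltrametricDist.norm_add_le_max _ _).trans ?_) ha0.le
    rw [max_mul_of_nonneg _ _ (norm_nonneg _), max_comm]
    refine max_le_max ?_ (h1.trans (by rw [mul_right_comm]))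
    rw [norm_pow]
    conv_lhs => rw [← Nat.sub_one_add_one hp.ne_zero, pow_succ]
    gcongr
  have hz : z ∈ Metric.closedBall z ρ := Metric.mem_closedBall_self hρ0
  have hφz : ‖φ z - z‖ = ρ := by
    have : φ z - z = (z ^ p - A * z + B) / A := by
      simp only [φ]; rw [eq_div_iff hA0, sub_mul, div_mul_cancel₀ _ hA0]; ring
    rw [this, norm_div, hAn]
  have hmaps : Set.MapsTo φ (Metric.closedBall z ρ) (Metric.closedBall z ρ) := by
    intro y hy
    have h1 := hlip y hy z hz
    rw [mem_closedBall_iff_norm] at hy ⊢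
    rw [← sub_add_sub_cancel _ (φ z) z]
    refine (IsUltrametricDist.norm_add_le_max _ _).trans (max_le (h1.trans ?_) hφz.le)
    calc κ * ‖y - z‖ ≤ 1 * ρ := by gcongr
      _ = ρ := one_mul ρ
  have hcontr : ContractingWith ⟨κ, hκ0⟩ (hmaps.restrict φ _ _) := by
    refine ⟨by exact_mod_cast hκ1, LipschitzWith.of_dist_le_mul fun y y' => ?_⟩
    have := hlip y y.2 y' y'.2
    rwa [← dist_eq_norm, ← dist_eq_norm] at this
  obtain ⟨α, hα, hfix, -⟩ := hcontr.exists_fixedPoint' (Metric.isClosed_closedBall.isComplete) hmaps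
    hz (edist_ne_top _ _)
  refine ⟨α, ?_, ?_⟩
  · have hfix' : (α ^ p + B) / A = α := hfix
    rw [div_eq_iff hA0] at hfix'
    linear_combination hfix'
  · rintro ⟨c, rfl⟩
    rw [mem_closedBall_iff_norm'] at hα
    exact ((hun c).trans_le hα).not_gt hρr

theorem nonempty_algEquiv_adjoinRoot {K L : Type*} [Field K] [Field L] [Algebra K L] {p : ℕ}
    (hp : p.Prime) (hdeg : Module.finrank K L = p) {F : K[X]} (hF : F.Monic)
    (hFd : F.natDegree = p) {α : L} (hα : aeval α F = 0) (hαK : α ∉ Set.range (algebraMap K L)) :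
    Nonempty (L ≃ₐ[K] AdjoinRoot F) := by
  have hint : IsIntegral K α := ⟨F, hF, hα⟩
  have hFm : F = minpoly K α := eq_of_monic_of_dvd_of_natDegree_le (minpoly.monic hint) hF
    (minpoly.dvd _ _ hα) (by rw [hFd, natDegree_minpoly_of_notMem_range hp hdeg hαK])
  rw [hFm]
  exact ⟨(((IntermediateField.adjoinRootEquivAdjoin K hint).trans
    (IntermediateField.equivOfEq (adjoin_eq_top_of_notMem_range hp hdeg hαK))).trans
      IntermediateField.topEquiv).symm⟩

theorem monic_and_natDegree_X_pow_sub_C_mul_X_add_C {R : Type*} [CommRing R] [Nontrivial R] {p : ℕ}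
    (hp : p.Prime) (a b : R) : (X ^ p - C a * X + C b : R[X]).Monic ∧
      (X ^ p - C a * X + C b : R[X]).natDegree = p := by
  have hlt : (C (-a) * X + C b : R[X]).degree < p :=
    degree_linear_lt.trans_le (by exact_mod_cast hp.two_le)
  have heq : (X ^ p - C a * X + C b : R[X]) = X ^ p + (C (-a) * X + C b) := by
    rw [C_neg]; ring
  rw [heq]
  refine ⟨monic_X_pow_add hlt, natDegree_eq_of_degree_eq_some ?_⟩
  rw [degree_add_eq_left_of_degree_lt (by rwa [degree_X_pow]), degree_X_pow]

end Root

section Immediate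

variable {K : Type*} [NormedField K] [IsUltrametricDist K]
  {L : Type*} [NormedField L] [IsUltrametricDist L] [NormedAlgebra K L]

/-- If every element of `L` is approximated by `K` and `L°` is a finite `K°`-algebra, then `L = K`:
the hypothesis says `L° = K° + 𝔪 L°`, where `𝔪` is the maximal ideal of `K°`, and Nakayama's lemma
applies. -/
theorem finrank_eq_one_of_finite (h : ∀ x : L, x ≠ 0 → ∃ c : K, ‖x - algebraMap K L c‖ < ‖x‖)
    [Module.Finite (Integers K) (Integers L)] : Module.finrank K L = 1 := by
  have hnorm : ∀ (x : L) (c : K), ‖x - algebraMap K L c‖ < ‖x‖ → ‖c‖ = ‖x‖ := by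
    intro x c hc
    rw [← norm_algebraMap' L]
    exact norm_eq_of_norm_sub_lt (by rwa [norm_sub_rev])
  have hmem : ∀ x : Integers L, ‖(x : L)‖ < 1 →
      x ∈ maximalIdeal (Integers K) • (⊤ : Submodule (Integers K) (Integers L)) := by
    intro x hx
    by_cases hx0 : (x : L) = 0
    · rw [show x = 0 from Subtype.ext hx0]; exact Submodule.zero_mem _
    obtain ⟨c, hc⟩ := h x hx0
    have hcn := hnorm _ _ hc
    have hc0 : algebraMap K L c ≠ 0 := by
      rw [← norm_ne_zero_iff, norm_algebraMap', hcn]; exact norm_ne_zero_iff.2 hx0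
    let y : Integers L := ⟨x / algebraMap K L c, mem_integers.2 (by
      rw [norm_div, norm_algebraMap', hcn, div_self (norm_ne_zero_iff.2 hx0)])⟩
    let c' : Integers K := ⟨c, mem_integers.2 (by rw [hcn]; exact hx.le)⟩
    have : x = c' • y := by
      rw [Algebra.smul_def]
      exact Subtype.ext (mul_div_cancel₀ _ hc0).symm
    rw [this]
    refine Submodule.smul_mem_smul ?_ trivial
    rw [← residue_eq_zero_iff, residue_eq_zero_iff_norm_lt]
    exact hcn.trans_lt hx
  have hle : (⊤ : Submodule (Integers K) (Integers L)) ≤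
      LinearMap.range (Algebra.linearMap (Integers K) (Integers L)) := by
    refine Submodule.le_of_le_smul_of_le_jacobson_bot (Module.Finite.fg_top)
      (IsLocalRing.maximalIdeal_le_jacobson _) fun x _ => ?_
    by_cases hx : ‖(x : L)‖ < 1
    · exact Submodule.mem_sup_right (hmem x hx)
    have hx1 : ‖(x : L)‖ = 1 := le_antisymm (mem_integers.1 x.2) (not_lt.1 hx)
    obtain ⟨c, hc⟩ := h x (by rw [← norm_ne_zero_iff, hx1]; exact one_ne_zero)
    let c' : Integers K := ⟨c, mem_integers.2 (by rw [hnorm _ _ hc, hx1])⟩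
    rw [← add_sub_cancel (algebraMap (Integers K) (Integers L) c') x]
    refine Submodule.add_mem_sup ⟨c', rfl⟩ (hmem _ ?_)
    rw [← hx1]
    exact hc
  rw [finrank_eq_one_iff_of_nonzero' (1 : L) one_ne_zero]
  intro x
  by_cases hx0 : x = 0
  · exact ⟨0, by rw [hx0, zero_smul]⟩
  obtain ⟨c, hc⟩ := h x hx0
  have hcn := hnorm _ _ hc
  have hc0 : algebraMap K L c ≠ 0 := by
    rw [← norm_ne_zero_iff, norm_algebraMap', hcn]; exact norm_ne_zero_iff.2 hx0
  obtain ⟨d, hd⟩ := hle (show (⟨x / algebraMap K L c, mem_integers.2 (by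
    rw [norm_div, norm_algebraMap', hcn, div_self (norm_ne_zero_iff.2 hx0)])⟩ : Integers L) ∈ ⊤
    from trivial)
  have hd' : algebraMap K L d = x / algebraMap K L c := congrArg Subtype.val hd
  refine ⟨d * c, ?_⟩
  rw [Algebra.smul_def, mul_one, map_mul, hd', div_mul_cancel₀ _ hc0]

theorem isIntegral_integers_of_exists_one_lt [CompleteSpace K] (hK : ∃ c : K, 1 < ‖c‖)
    [Algebra.IsAlgebraic K L] : Algebra.IsIntegral (Integers K) (Integers L) := by
  let _ : NontriviallyNormedField K := { ‹NormedField K› with non_trivial := hK }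
  exact isIntegral_integers K L

/-- An extension of degree `p` in which every element is approximated by the base field is wildly
ramified: if it had an unramified subextension of degree `p`, the integers of the latter would be
finite over `K°`. -/
theorem isWildlyRamified_of_forall_exists {p : ℕ} (hp : p.Prime) [CompleteSpace K]
    (hK : ∃ c : K, 1 < ‖c‖) (hdeg : Module.finrank K L = p)
    (h : ∀ x : L, x ≠ 0 → ∃ c : K, ‖x - algebraMap K L c‖ < ‖x‖) : IsWildlyRamified K L p := by
  have : FiniteDimensional K L := Module.finite_of_finrank_pos (hdeg ▸ hp.pos)
  refine ⟨this, ?_⟩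
  rintro ⟨-, F, ⟨-, het⟩, hcop⟩
  have hmul := Module.finrank_mul_finrank K F L
  rw [hdeg] at hmul
  have := isIntegral_integers_of_exists_one_lt (L := F) hK
  have : Module.Finite (Integers K) (Integers F) := Algebra.IsIntegral.finite
  have hF : Module.finrank K F = 1 := finrank_eq_one_of_finite fun x hx => by
    obtain ⟨c, hc⟩ := h x (by simpa using hx)
    exact ⟨c, hc⟩
  rw [hF, one_mul] at hmul
  rw [hmul, Nat.coprime_self] at hcop
  exact hp.one_lt.ne' hcop

/-- In degree less than `p`, the base field itself serves as the unramified subextension. -/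
theorem isModeratelyRamified_of_finrank_lt {p : ℕ} (hp : p.Prime) [FiniteDimensional K L]
    (hlt : Module.finrank K L < p) : IsModeratelyRamified K L p := by
  refine ⟨inferInstance, ⊥, ⟨inferInstance, ?_⟩, ?_⟩
  · have hbij : Function.Bijective
        (Algebra.ofId (Integers K) (Integers (⊥ : IntermediateField K L))) := by
      refine ⟨fun x y hxy => ?_, fun y => ?_⟩
      · have h1 : algebraMap K (⊥ : IntermediateField K L) x =
            algebraMap K (⊥ : IntermediateField K L) y := congrArg Subtype.val hxy
        exact Subtype.ext ((algebraMap K (⊥ : IntermediateField K L)).injective h1)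
      · obtain ⟨c, hc⟩ := IntermediateField.mem_bot.1 y.1.2
        have hcn : ‖c‖ ≤ 1 := by
          rw [← norm_algebraMap' L, hc]; exact mem_integers.1 y.2
        exact ⟨⟨c, mem_integers.2 hcn⟩, Subtype.ext (Subtype.ext hc)⟩
    exact Algebra.Etale.of_equiv (AlgEquiv.ofBijective _ hbij)
  · rw [IntermediateField.finrank_bot']
    exact (hp.coprime_iff_not_dvd.2
      (Nat.not_dvd_of_pos_of_lt Module.finrank_pos hlt)).symm

end Immediate

section Invariants

variable {K : Type*} [NormedField K]
  {L : Type*} [NormedField L] [IsUltrametricDist L] [NormedAlgebra K L] {p : ℕ}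

/-- In prime degree `p`, an element whose distance to `K` is not attained generates `L`, so that
every element of `L` is a polynomial of degree less than `p` in it and is approximated by `K`. -/
theorem IsUnattainedDistance.forall_exists_norm_sub_lt (hp : p.Prime) (hpL : ‖(p : L)‖ < 1)
    (hdeg : Module.finrank K L = p) {z : L} {r : ℝ} (hz : IsUnattainedDistance K z r) (x : L)
    (hx : x ≠ 0) : ∃ c : K, ‖x - algebraMap K L c‖ < ‖x‖ := by
  obtain ⟨g, hg, rfl⟩ := exists_aeval_eq_of_notMem_range hp hdeg hz.notMem_range x
  exact hz.exists_norm_aeval_sub_lt hp hpL g (by rintro rfl; simp at hx) hg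

theorem isPthPowerValue_pow_iff (hp : p.Prime) {r : ℝ} (hr : 0 < r) :
    IsPthPowerValue K p (r ^ p) ↔ ∃ c : K, ‖c‖ = r := by
  constructor
  · rintro ⟨c, -, hc⟩
    exact ⟨c, ((pow_left_inj₀ hr.le (norm_nonneg _) hp.ne_zero).1 hc).symm⟩
  · rintro ⟨c, rfl⟩
    exact ⟨c, norm_pos_iff.1 hr, rfl⟩

theorem IsApproximateRoot.eq_zero_of_isAttained (hp : p.Prime) (hpL : ‖(p : L)‖ < 1)
    {b a : K} {z : L} {r : ℝ} (h : IsApproximateRoot p b a z r)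
    (hatt : IsAttained p b a (r ^ p)) : a = 0 := by
  obtain ⟨c, hc⟩ := (h.isAttained_iff hp hpL).1 hatt
  exact h.alternative.resolve_right fun h' => (h'.2 c).ne' hc

variable [IsUltrametricDist K]

namespace IsApproximateRoot

variable {b a : K} {z : L} {r : ℝ}

theorem isImmediate_of_not_isAttained (hp : p.Prime) (hpL : ‖(p : L)‖ < 1)
    (hdeg : Module.finrank K L = p) (h : IsApproximateRoot p b a z r)
    (hatt : ¬ IsAttained p b a (r ^ p)) : IsImmediate K L := by
  rw [h.isAttained_iff hp hpL] at hatt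
  push Not at hatt
  have hz : IsUnattainedDistance K z r :=
    ⟨h.isDistance, fun c => (h.isDistance.le c).lt_of_ne (hatt c).symm⟩
  exact isImmediate_of_forall_exists (hz.forall_exists_norm_sub_lt hp hpL hdeg)

theorem invariants_of_not_isPthPowerValue (hp : p.Prime) (hpL : ‖(p : L)‖ < 1)
    (hdeg : Module.finrank K L = p) (h : IsApproximateRoot p b a z r)
    (hatt : IsAttained p b a (r ^ p)) (hs : ¬ IsPthPowerValue K p (r ^ p)) :
    ramificationIndex K L = p ∧ residueDegree K L = 1 ∧
      ∃ g : ℝˣ, (g : ℝ) = r ∧ valueGroup L = valueGroup K ⊔ Subgroup.zpowers g := by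
  have hr := h.isDistance.pos
  rw [isPthPowerValue_pow_iff hp hr] at hs
  obtain ⟨c, hc⟩ := (h.isAttained_iff hp hpL).1 hatt
  obtain ⟨y, -, hy⟩ := hatt
  obtain ⟨h1, h2, h3⟩ := invariants_of_norm_notMem (K := K) hp (Units.mk0 r hr.ne') hc
    (fun hmem => hs (mem_valueGroup.1 hmem)) (mem_valueGroup.2 ⟨y, hy⟩)
    (exists_aeval_eq_of_notMem_range hp hdeg (h.isDistance.sub_algebraMap c).notMem_range)
  exact ⟨h2, h3, _, rfl, h1⟩

/-- The case `f = p`, where the coset has an element of norm `r ^ p` and `r` is a value on `K`. -/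
theorem exists_residue_generator (hp : p.Prime) [CharP (Residue K) p]
    (hdeg : Module.finrank K L = p) (h : IsApproximateRoot p b 0 z r) {y : K}
    (hy : y ∈ coset p b 0 (r ^ p)) (hyn : ‖y‖ = r ^ p) {c : K} (hc : ‖c‖ = r) :
    (ramificationIndex K L = 1 ∧ residueDegree K L = p) ∧
    IsPurelyInseparable (Residue K) (Residue L) ∧
    ∃ v : Integers K, (v : K) = y / c ^ p ∧ ∃ t : Residue L,
      t ^ p = algebraMap (Residue K) (Residue L) (residue (Integers K) v) ∧
        IntermediateField.adjoin (Residue K) {t} = ⊤ := by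
  obtain ⟨v, hv, t, hpow, hd, htK⟩ := h.exists_residue hp hy hyn hc
  obtain ⟨htop, he, hf⟩ := invariants_of_natDegree_minpoly_residue hp hd
    (exists_aeval_eq_of_notMem_range hp hdeg htK)
  exact ⟨⟨he, hf⟩, isPurelyInseparable_of_pow_eq hp hpow htop, v, hv, _, hpow, htop⟩

end IsApproximateRoot

end Invariants

section BaseChange

variable {K : Type*} [NormedField K] {L : Type*} [NormedField L] [NormedAlgebra K L] {p : ℕ}
  {K' : Type*} [NormedField K'] [NormedAlgebra K K'] {L' : Type*} [NormedField L']
  [NormedAlgebra L L'] [NormedAlgebra K' L'] [Algebra K L'] [IsScalarTower K L L']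
  [IsScalarTower K K' L']

theorem finrank_lt_of_pow_eq {K K' : Type*} [Field K] [Field K'] [Algebra K K'] (hp : p.Prime)
    {a : K} {u : K'} (hu : u ^ (p - 1) = algebraMap K K' a)
    (htop : IntermediateField.adjoin K {u} = ⊤) :
    FiniteDimensional K K' ∧ Module.finrank K K' < p := by
  have hp1 : p - 1 ≠ 0 := by have := hp.two_le; omega
  have hmon : (X ^ (p - 1) - C a).Monic := monic_X_pow_sub_C a hp1
  have hroot : aeval u (X ^ (p - 1) - C a) = 0 := by simp [hu]
  have hint : IsIntegral K u := ⟨_, hmon, hroot⟩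
  have hfd : FiniteDimensional K (IntermediateField.adjoin K {u}) :=
    IntermediateField.adjoin.finiteDimensional hint
  have hfr := IntermediateField.adjoin.finrank hint
  rw [htop, IntermediateField.finrank_top'] at hfr
  have hle := natDegree_le_of_dvd (minpoly.dvd _ _ hroot) hmon.ne_zero
  rw [natDegree_X_pow_sub_C] at hle
  have hpos := minpoly.natDegree_pos hint
  exact ⟨Module.finite_of_finrank_pos (by omega), by omega⟩

/-- Dividing by `u`, where `u ^ (p - 1) = a`, turns the equation `T ^ p - a T + b = 0` into the
Artin–Schreier equation `T ^ p - T + b / u ^ p = 0`. -/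
theorem IsApproximateRoot.baseChange (hp : p.Prime) {b a : K} {z : L} {r : ℝ}
    (h : IsApproximateRoot p b a z r)
    (hz' : IsUnattainedDistance K' (algebraMap L L' z) r) {u : K'} (hun : ‖u‖ = r)
    (hu : u ^ (p - 1) = algebraMap K K' a) :
    IsApproximateRoot p (algebraMap K K' b / u ^ p) 1 (algebraMap L L' z / algebraMap K' L' u) 1 ∧
      ∀ c : K', 1 < ‖algebraMap L L' z / algebraMap K' L' u - algebraMap K' L' c‖ := by
  have hr := h.isDistance.pos
  have hu0 : u ≠ 0 := by rw [← norm_ne_zero_iff, hun]; exact hr.ne'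
  set U := algebraMap K' L' u with hU
  have hUn : ‖U‖ = r := by rw [hU, norm_algebraMap', hun]
  have hU0 : U ≠ 0 := by rw [← norm_ne_zero_iff, hUn]; exact hr.ne'
  have hscale : ∀ c : K', ‖algebraMap L L' z / U - algebraMap K' L' c‖ =
      ‖algebraMap L L' z - algebraMap K' L' (u * c)‖ / r := by
    intro c
    rw [div_sub' hU0, norm_div, hUn, map_mul]
  have hlt : ∀ c : K', 1 < ‖algebraMap L L' z / U - algebraMap K' L' c‖ := by
    intro c
    rw [hscale, one_lt_div hr]
    exact hz'.lt _
  refine ⟨⟨⟨one_pos, fun c => (hlt c).le, fun ρ hρ => ?_⟩, ?_, ?_, Or.inr ⟨?_, hlt⟩⟩, hlt⟩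
  · obtain ⟨c, hc⟩ := hz'.exists_lt (ρ * r) (lt_mul_of_one_lt_left hr hρ)
    refine ⟨c / u, ?_⟩
    rwa [hscale, mul_div_cancel₀ _ hu0, div_lt_iff₀ hr]
  · have h1 : ‖(p : L') * algebraMap L L' z ^ p‖ < r ^ p := by
      rw [← map_natCast (algebraMap L L'), ← map_pow, ← map_mul, norm_algebraMap']
      exact h.norm_mul_pow_lt
    rw [one_pow, div_pow, ← mul_div_assoc, norm_div, norm_pow, hUn, div_lt_one (pow_pos hr p)]
    exact h1
  · have h1 : ‖algebraMap L L' (z ^ p - algebraMap K L a * z + algebraMap K L b)‖ < r ^ p := by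
      rw [norm_algebraMap']; exact h.norm_lt
    have h2 : (algebraMap L L' z / U) ^ p - algebraMap K' L' 1 * (algebraMap L L' z / U) +
        algebraMap K' L' (algebraMap K K' b / u ^ p) =
        algebraMap L L' (z ^ p - algebraMap K L a * z + algebraMap K L b) / U ^ p := by
      have h3 : U ^ p = algebraMap L L' (algebraMap K L a) * U := by
        rw [← IsScalarTower.algebraMap_apply K L L', IsScalarTower.algebraMap_apply K K' L', ← hu,
          map_pow, pow_sub_one_mul hp.ne_zero]
      have h4 : algebraMap L L' (algebraMap K L b) = algebraMap K' L' (algebraMap K K' b) := by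
        rw [← IsScalarTower.algebraMap_apply, ← IsScalarTower.algebraMap_apply]
      have h5 : algebraMap L L' z / U =
          algebraMap L L' (algebraMap K L a) * algebraMap L L' z / U ^ p := by
        rw [div_eq_div_iff hU0 (pow_ne_zero p hU0), h3]; ring
      rw [map_one, one_mul]
      conv_lhs => rw [div_pow]
      rw [h5, map_add, map_sub, map_mul, map_pow, map_div₀, map_pow, h4, ← hU]
      ring
    rw [h2, one_pow, norm_div, norm_pow, hUn, div_lt_one (pow_pos hr p)]
    exact h1
  · rw [norm_one, one_pow]

variable [IsUltrametricDist L']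

/-- The distance to `K` does not decrease under a base field extension of degree less than `p`. -/
theorem IsUnattainedDistance.baseChange (hp : p.Prime) (hpL : ‖(p : L)‖ < 1) {z : L} {r : ℝ}
    (hz : IsUnattainedDistance K z r) [FiniteDimensional K K'] (hlt : Module.finrank K K' < p) :
    IsUnattainedDistance K' (algebraMap L L' z) r := by
  let _ : NormedAlgebra K L' :=
    { ‹Algebra K L'› with
      norm_smul_le := fun c x => by
        rw [Algebra.smul_def, IsScalarTower.algebraMap_apply K L L', norm_mul, norm_algebraMap',
          norm_algebraMap'] }
  have hnorm : ∀ c : K, ‖algebraMap L L' z - algebraMap K L' c‖ = ‖z - algebraMap K L c‖ := by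
    intro c
    rw [IsScalarTower.algebraMap_apply K L L', ← map_sub, norm_algebraMap']
  have hzK : IsUnattainedDistance K (algebraMap L L' z) r :=
    ⟨⟨hz.pos, fun c => by rw [hnorm]; exact hz.le c, fun ρ hρ => by
      obtain ⟨c, hc⟩ := hz.exists_lt ρ hρ
      exact ⟨c, by rwa [hnorm]⟩⟩, fun c => by rw [hnorm]; exact hz.lt c⟩
  have hpL' : ‖(p : L')‖ < 1 := by
    rw [← map_natCast (algebraMap L L'), norm_algebraMap']; exact hpL
  have hlow : ∀ c : K', r < ‖algebraMap L L' z - algebraMap K' L' c‖ := by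
    intro c
    have hint : IsIntegral K c := Algebra.IsIntegral.isIntegral c
    refine hzK.lt_norm_sub_of_natDegree_lt hp hpL' (minpoly K c) (minpoly.ne_zero hint)
      ((minpoly.natDegree_le c).trans_lt hlt) ?_
    rw [aeval_algebraMap_apply, minpoly.aeval, map_zero]
  refine ⟨⟨hz.pos, fun c => (hlow c).le, fun ρ hρ => ?_⟩, hlow⟩
  obtain ⟨c, hc⟩ := hzK.exists_lt ρ hρ
  exact ⟨algebraMap K K' c, by rwa [← IsScalarTower.algebraMap_apply K K' L']⟩

/-- `L'` is generated over `K'` by the image of `z`, whose degree over `K'` is at most its degree `p`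
over `K`, and at least `p` by stability over `K'`. -/
theorem finrank_baseChange (hp : p.Prime) (hpL : ‖(p : L)‖ < 1) (hdeg : Module.finrank K L = p)
    {z : L} {r : ℝ} (hz : IsUnattainedDistance K z r)
    (hz' : IsUnattainedDistance K' (algebraMap L L' z) r) {u : K'}
    (htop : IntermediateField.adjoin L {algebraMap K' L' u} = ⊤) : Module.finrank K' L' = p := by
  have : FiniteDimensional K L := Module.finite_of_finrank_pos (hdeg ▸ hp.pos)
  set z' := algebraMap L L' z with hz'def
  have hpL' : ‖(p : L')‖ < 1 := by
    rw [← map_natCast (algebraMap L L'), norm_algebraMap']; exact hpL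
  have hzint : IsIntegral K z := Algebra.IsIntegral.isIntegral z
  have hroot : aeval z' ((minpoly K z).map (algebraMap K K')) = 0 := by
    rw [aeval_map_algebraMap, hz'def, aeval_algebraMap_apply, minpoly.aeval, map_zero]
  have hmon := (minpoly.monic hzint).map (algebraMap K K')
  have hint : IsIntegral K' z' := ⟨_, hmon, hroot⟩
  have hadj : IntermediateField.adjoin K' {z'} = ⊤ := by
    have hL : ∀ x : L, algebraMap L L' x ∈ (IntermediateField.adjoin K' {z'}).toSubfield := by
      intro x
      obtain ⟨g, -, rfl⟩ := exists_aeval_eq_of_notMem_range hp hdeg hz.notMem_range x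
      rw [← aeval_algebraMap_apply, ← aeval_map_algebraMap K']
      exact IntermediateField.algebra_adjoin_le_adjoin _ _ (aeval_mem_adjoin_singleton _ _)
    have hle : IntermediateField.adjoin L {algebraMap K' L' u} ≤
        (IntermediateField.adjoin K' {z'}).toSubfield.toIntermediateField hL := by
      rw [IntermediateField.adjoin_simple_le_iff]
      exact (IntermediateField.adjoin K' {z'}).algebraMap_mem u
    rw [htop] at hle
    exact eq_top_iff.2 fun x _ => hle (IntermediateField.mem_top (x := x))
  rw [← IntermediateField.finrank_top', ← hadj, IntermediateField.adjoin.finrank hint]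
  refine le_antisymm ?_ (not_lt.1 fun hlt => ?_)
  · have := natDegree_le_of_dvd (minpoly.dvd _ _ hroot) hmon.ne_zero
    rwa [(minpoly.monic hzint).natDegree_map,
      natDegree_minpoly_of_notMem_range hp hdeg hz.notMem_range] at this
  · obtain ⟨c, hc⟩ := hz'.exists_norm_aeval_sub_lt hp hpL' _ (minpoly.ne_zero hint) hlt
    rw [minpoly.aeval, norm_zero] at hc
    exact hc.not_ge (norm_nonneg _)

end BaseChange

end AnalyticField

/-! ### Wildly ramified extensions of prime degree -/

open AnalyticField Polynomial in
theorem mainTheorem11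
    (p : ℕ) (hp : p.Prime)
    (K : Type*) [NontriviallyNormedField K] [IsUltrametricDist K] [CompleteSpace K]
    [CharP (Residue K) p]
    (L : Type*) [NormedField L] [IsUltrametricDist L] [NormedAlgebra K L]
    (hdeg : Module.finrank K L = p) (hwild : IsWildlyRamified K L p) :
    -- existence of a critical coset split over `L`
    (∃ (b a : K) (s : ℝ), IsCriticalSplitOver K L p b a s ∧
      (a = 0 ∨ IsNonattainedOfEqual p b a s)) ∧
    -- the identity `d e f = p`
    (∃ d : ℕ, defect K L = d ∧ d * ramificationIndex K L * residueDegree K L = p) ∧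
    -- what every such coset says about `L / K`
    ∀ (b a : K) (s : ℝ), IsCriticalSplitOver K L p b a s →
      (a = 0 ∨ IsNonattainedOfEqual p b a s) →
      (a = 0 → IsSpecial p b a s) ∧
      -- `K' = K(u)` and `L' = L(u)` with `u ^ (p - 1) = a`
      (IsNonattainedOfEqual p b a s →
        ∀ (K' : Type*) [NormedField K'] [IsUltrametricDist K'] [NormedAlgebra K K']
          (L' : Type*) [NormedField L'] [IsUltrametricDist L'] [NormedAlgebra L L']
          [NormedAlgebra K' L'] [Algebra K L'] [IsScalarTower K L L'] [IsScalarTower K K' L']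
          (u : K'), u ^ (p - 1) = algebraMap K K' a →
          IntermediateField.adjoin K {u} = ⊤ →
          IntermediateField.adjoin L {algebraMap K' L' u} = ⊤ →
          IsModeratelyRamified K K' p ∧
          Module.finrank K' L' = p ∧ IsWildlyRamified K' L' p ∧
          ∃ (b' a' : K') (s' : ℝ), IsSpecial p b' a' s' ∧
            IsCriticalSplitOver K' L' p b' a' s' ∧ IsNonattainedOfEqual p b' a' s') ∧
      (IsNonattainedOfEqual p b a s →
        Nonempty (L ≃ₐ[K] AdjoinRoot (X ^ p - C a * X + C b : K[X]))) ∧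
      -- the immediate case
      ((IsImmediate K L ↔ ¬ IsAttained p b a s) ∧ (defect K L = p ↔ ¬ IsAttained p b a s) ∧
        (IsNonattainedOfEqual p b a s → IsImmediate K L)) ∧
      -- the case `e = p`
      ((ramificationIndex K L = p ↔ IsAttained p b a s ∧ ¬ IsPthPowerValue K p s) ∧
        (ramificationIndex K L = p → ∃ g : ℝˣ, (g : ℝ) = s ^ (1 / (p : ℝ)) ∧
          valueGroup L = valueGroup K ⊔ Subgroup.zpowers g)) ∧
      -- the case `f = p`
      ((residueDegree K L = p ↔ IsAttained p b a s ∧ IsPthPowerValue K p s) ∧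
        (residueDegree K L = p → IsPurelyInseparable (Residue K) (Residue L) ∧
          ∀ y ∈ coset p b a s, ∀ c : K, ‖y‖ = s → ‖c‖ = s ^ (1 / (p : ℝ)) →
            ∃ z : Integers K, (z : K) = y / c ^ p ∧
              ∃ t : Residue L,
                t ^ p = algebraMap (Residue K) (Residue L) (IsLocalRing.residue (Integers K) z) ∧
                IntermediateField.adjoin (Residue K) {t} = ⊤)) := by
  have : FiniteDimensional K L := hwild.1
  have hpK : ‖(p : K)‖ < 1 := norm_natCast_lt_one p
  have hpL : ‖(p : L)‖ < 1 := by rwa [← map_natCast (algebraMap K L), norm_algebraMap']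
  have hp1 : p ≠ 1 := hp.one_lt.ne'
  have hpQ : (p : ℚ) ≠ 0 := by exact_mod_cast hp.ne_zero
  obtain ⟨b₀, a₀, z₀, r₀, h₀⟩ := hwild.exists_isApproximateRoot hp hdeg
  have hr₀ := h₀.isDistance.pos
  refine ⟨⟨b₀, a₀, r₀ ^ p, h₀.isCriticalSplitOver hp hpL, ?_⟩, ?_, ?_⟩
  · refine h₀.alternative.imp id fun h =>
      ⟨by rw [h.1, pow_rpow_sub_one_div hp hr₀.le], fun hatt => ?_⟩
    obtain ⟨c, hc⟩ := (h₀.isAttained_iff hp hpL).1 hatt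
    exact (h.2 c).ne' hc
  · by_cases hatt : IsAttained p b₀ a₀ (r₀ ^ p)
    · by_cases hs : IsPthPowerValue K p (r₀ ^ p)
      · obtain ⟨c, hc⟩ := (isPthPowerValue_pow_iff hp hr₀).1 hs
        obtain rfl := h₀.eq_zero_of_isAttained hp hpL hatt
        obtain ⟨y, hy, hyn⟩ := hatt
        obtain ⟨⟨he, hf⟩, -⟩ := h₀.exists_residue_generator hp hdeg hy hyn hc
        exact ⟨1, by rw [defect, hdeg, he, hf]; simp [hpQ], by rw [he, hf, one_mul, one_mul]⟩
      · obtain ⟨he, hf, -⟩ := h₀.invariants_of_not_isPthPowerValue hp hpL hdeg hatt hs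
        exact ⟨1, by rw [defect, hdeg, he, hf]; simp [hpQ], by rw [he, hf, one_mul, mul_one]⟩
    · obtain ⟨he, hf⟩ := h₀.isImmediate_of_not_isAttained hp hpL hdeg hatt
      exact ⟨p, by rw [defect, hdeg, he, hf]; simp, by rw [he, hf, mul_one, mul_one]⟩
  · intro b a s hcrit halt
    obtain ⟨z, r, rfl, h⟩ := hcrit.exists_isApproximateRoot hp hpL halt
    have hr := h.isDistance.pos
    have hroot : (r ^ p) ^ (1 / (p : ℝ)) = r := by
      rw [one_div, Real.pow_rpow_inv_natCast hr.le hp.ne_zero]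
    have hcase : IsNonattainedOfEqual p b a (r ^ p) →
        ‖a‖ = r ^ (p - 1) ∧ IsUnattainedDistance K z r := by
      rintro ⟨h1, h2⟩
      rw [pow_rpow_sub_one_div hp hr.le] at h1
      rw [h.isAttained_iff hp hpL] at h2
      push Not at h2
      exact ⟨h1, h.isDistance, fun c => (h.isDistance.le c).lt_of_ne (h2 c).symm⟩
    -- the three possible values of `(e, f)`
    have himm := h.isImmediate_of_not_isAttained hp hpL hdeg
    have hram := h.invariants_of_not_isPthPowerValue hp hpL hdeg
    have hres : IsAttained p b a (r ^ p) → IsPthPowerValue K p (r ^ p) →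
        ramificationIndex K L = 1 ∧ residueDegree K L = p := by
      rintro hatt hs
      obtain ⟨c, hc⟩ := (isPthPowerValue_pow_iff hp hr).1 hs
      obtain rfl := h.eq_zero_of_isAttained hp hpL hatt
      obtain ⟨y, hy, hyn⟩ := hatt
      exact (h.exists_residue_generator hp hdeg hy hyn hc).1
    refine ⟨fun ha => ⟨hcrit.1, Or.inl ha⟩, ?_, ?_, ⟨?_, ?_, fun hn => himm hn.2⟩, ⟨?_, ?_⟩, ?_, ?_⟩
    · intro hn K' _ _ _ L' _ _ _ _ _ _ _ u hu htop htop'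
      obtain ⟨ha, hz⟩ := hcase hn
      obtain ⟨hfd, hlt⟩ := finrank_lt_of_pow_eq hp hu htop
      have hp0 : p - 1 ≠ 0 := by have := hp.two_le; omega
      have hun : ‖u‖ = r := by
        rw [← pow_left_inj₀ (norm_nonneg u) hr.le hp0, ← norm_pow, hu, norm_algebraMap', ha]
      have hpL' : ‖(p : L')‖ < 1 := by rwa [← map_natCast (algebraMap L L'), norm_algebraMap']
      have hz' : IsUnattainedDistance K' (algebraMap L L' z) r := hz.baseChange hp hpL hlt
      have hdeg' : Module.finrank K' L' = p := finrank_baseChange hp hpL hdeg hz hz' htop'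
      have : CompleteSpace K' := FiniteDimensional.complete K K'
      obtain ⟨c, hc⟩ := NormedField.exists_one_lt_norm K
      obtain ⟨h', hlt'⟩ := h.baseChange hp hz' hun hu
      have hcrit' := h'.isCriticalSplitOver hp hpL'
      rw [one_pow] at hcrit'
      refine ⟨isModeratelyRamified_of_finrank_lt hp hlt, hdeg',
        isWildlyRamified_of_forall_exists hp ⟨algebraMap K K' c, by rwa [norm_algebraMap']⟩ hdeg'
          (hz'.forall_exists_norm_sub_lt hp hpL' hdeg'),
        _, 1, 1, ⟨hcrit'.1, Or.inr ⟨rfl, rfl⟩⟩, hcrit', ?_, fun hatt => ?_⟩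
      · rw [norm_one, Real.one_rpow]
      · have hatt' := h'.isAttained_iff hp hpL'
        rw [one_pow] at hatt'
        obtain ⟨c, hc⟩ := hatt'.1 hatt
        exact (hlt' c).ne' hc
    · intro hn
      obtain ⟨ha, hz⟩ := hcase hn
      have : CompleteSpace L := FiniteDimensional.complete K L
      obtain ⟨α, hα, hαK⟩ := h.exists_root hp ha hz.lt
      obtain ⟨hmon, hnat⟩ := monic_and_natDegree_X_pow_sub_C_mul_X_add_C hp a b
      exact nonempty_algEquiv_adjoinRoot hp hdeg hmon hnat (by simpa using hα) hαK
    · refine ⟨fun hI hatt => ?_, himm⟩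
      by_cases hs : IsPthPowerValue K p (r ^ p)
      · exact hp1 ((hres hatt hs).2.symm.trans hI.2)
      · exact hp1 ((hram hatt hs).1.symm.trans hI.1)
    · refine ⟨fun hd hatt => ?_, fun hatt => ?_⟩
      · have hone : defect K L = 1 := by
          by_cases hs : IsPthPowerValue K p (r ^ p)
          · rw [defect, hdeg, (hres hatt hs).1, (hres hatt hs).2]; simp [hpQ]
          · rw [defect, hdeg, (hram hatt hs).1, (hram hatt hs).2.1]; simp [hpQ]
        rw [hone] at hd
        exact hp1 (by exact_mod_cast hd.symm)
      · rw [defect, hdeg, (himm hatt).1, (himm hatt).2]; simp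
    · refine ⟨fun he => ?_, fun h' => (hram h'.1 h'.2).1⟩
      by_cases hatt : IsAttained p b a (r ^ p)
      · exact ⟨hatt, fun hs => hp1 (he.symm.trans (hres hatt hs).1)⟩
      · exact absurd (he.symm.trans (himm hatt).1) hp1
    · intro he
      rw [hroot]
      by_cases hatt : IsAttained p b a (r ^ p)
      · exact (hram hatt fun hs => hp1 (he.symm.trans (hres hatt hs).1)).2.2
      · exact absurd (he.symm.trans (himm hatt).1) hp1
    · refine ⟨fun hf => ?_, fun h' => (hres h'.1 h'.2).2⟩
      by_cases hatt : IsAttained p b a (r ^ p)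
      · refine ⟨hatt, ?_⟩
        by_contra hs
        exact hp1 (hf.symm.trans (hram hatt hs).2.1)
      · exact absurd (hf.symm.trans (himm hatt).2) hp1
    · intro hf
      have hatt : IsAttained p b a (r ^ p) := by
        by_contra hatt
        exact hp1 (hf.symm.trans (himm hatt).2)
      have hs : IsPthPowerValue K p (r ^ p) := by
        by_contra hs
        exact hp1 (hf.symm.trans (hram hatt hs).2.1)
      obtain rfl := h.eq_zero_of_isAttained hp hpL hatt
      obtain ⟨c₀, hc₀⟩ := (isPthPowerValue_pow_iff hp hr).1 hs
      obtain ⟨y₀, hy₀, hyn₀⟩ := hatt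
      refine ⟨(h.exists_residue_generator hp hdeg hy₀ hyn₀ hc₀).2.1, fun y hy c hyn hc => ?_⟩
      rw [hroot] at hc
      exact (h.exists_residue_generator hp hdeg hy hyn hc).2.2
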